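/- Let $K$ be a field and let $(E,w)$ be a finite weighted graph with at least one vertex: $E=(E^0,E^1,s,r)$ is a directed graph with $E^0\neq\emptyset$ and $E^1$ finite sets, and $w:E^1\to\{1,2,\dots\}$. A vertex $v$ is regular if $s^{-1}(v)\neq\emptyset$, and then $w(v):=\max\{w(e)\mid e\in s^{-1}(v)\}$. Let $\hat E$ be the directed graph with vertex set $E^0$ and edges $e_1,\dots,e_{w(e)}$ from $s(e)$ to $r(e)$ for each $e\in E^1$, and let $\hat E_d$ be its double graph, obtained by adding for each edge $e_i$ a ghost edge $e_i^*$ from $r(e)$ to $s(e)$. The weighted Leavitt path algebra $L_K(E,w)$ is the (not necessarily unital) associative $K$-algebra generated by the vertices and edges of $\hat E_d$ subject to the relations $uv=\delta_{uv}u$ for vertices $u,v$; $s(x)x=x=x\,r(x)$ for edges $x$ of $\hat E_d$; and, for each regular vertex $v$, \[\sum_{e\in s^{-1}(v)}e_ie_j^*=\delta_{ij}v\quad(1\le i,j\le w(v)),\qquad \sum_{1\le i\le w(v)}e_i^*f_i=\delta_{ef}\,r(e)\quad(e,f\in s^{-1}(v)),\] where $e_i$ and $e_i^*$ are read as $0$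 if $i>w(e)$. Fix for every regular vertex $v$ an edge $e^v\in s^{-1}(v)$ with $w(e^v)=w(v)$. The words $e^v_i(e^v_j)^*$ ($1\le i,j\le w(v)$) and $e_1^*f_1$ ($e,f\in s^{-1}(v)$), for $v$ regular, are called forbidden. A path in $\hat E_d$ is either a single vertex (length $0$) or a nonempty word of composable edges of $\hat E_d$; a nod-path is a path in $\hat E_d$ without forbidden subwords (subwords are contiguous). For nod-paths $p,q$ write $p\overset{\mathrm{nod}}{\Longrightarrow}q$ if there is a nod-path $o$ such that $p$ is not a prefix of $o$ and the word $poq$ is a nod-path, and write $p\Longrightarrow q$ if the word $pq$ is a nod-path or $p\overset{\mathrm{nod}}{\Longrightarrow}q$. A nod$^2$-path is a nod-path $p$ such that the word $p^2$ is a nod-path. A quasi-cycle is a nod$^2$-path $p$ such that no subword of $p^2$ of length less than $|p|$ is a nod$^2$-path; it is selfconnected if $p\overset{\mathrm{nod}}{\Longrightarrow}p$. Two quasi-cycles are equivalent, $p\approx q$, if $q$ is a cyclic rotation of the word $p$. A chain of length $k\ge 0$ is a sequence $p_1,\dots,p_k$ of pairwise non-equivalent quasi-cycles with $p_1\Longrightarrow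 p_2\Longrightarrow\dots\Longrightarrow p_k$. For a $K$-algebra $A$ with a finite-dimensional generating subspace $V$, let $V^n$ be the span of all products of $k$ elements of $V$, $1\le k\le n$, and $d_V(n)=\dim_K V^n$. $A$ has polynomial growth if for some positive integers $m$ and $c$ one has $d_V(n)\le c(cn)^m$ for all $n\ge1$, and $\operatorname{GKdim}A=\limsup_{n\to\infty}\log_n d_V(n)$; neither notion depends on the choice of $V$. Then: (i) $L_K(E,w)$ has polynomial growth if and only if there is no selfconnected quasi-cycle. (ii) If $L_K(E,w)$ has polynomial growth, then the chains of quasi-cycles have a maximal length $d$, and $\operatorname{GKdim}L_K(E,w)=d$. -/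

import Mathlib

/-! ### Directed graphs, double graphs, paths -/

/-- A directed graph with vertex set `V` and edge set `E`. -/
structure DirGraph (V E : Type*) where
  src : E → V
  rng : E → V

namespace DirGraph

variable {V E : Type*}

/-- The double graph: `Sum.inl e` is the real edge `e`, `Sum.inr e` is the ghost edge `e*`. -/
def double (G : DirGraph V E) : DirGraph V (E ⊕ E) where
  src := Sum.elim G.src G.rng
  rng := Sum.elim G.rng G.src

/-- A path is a word over the alphabet `V ⊕ E` that is either a single vertex or a nonempty word
of composable edges. -/
def IsPath (G : DirGraph V E) (p : List (V ⊕ E)) : Prop :=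
  (∃ v : V, p = [Sum.inl v]) ∨
    ∃ l : List E, l ≠ [] ∧ l.IsChain (fun x y => G.rng x = G.src y) ∧ p = l.map Sum.inr

end DirGraph

/-- The length of a path: the number of its edges (so a vertex has length `0`). -/
def pathLength {V E : Type*} (p : List (V ⊕ E)) : ℕ := p.countP Sum.isRight

/-! ### Quotients of (not necessarily unital) algebras by relations -/

section Quotient

variable (K : Type*) {A : Type*} [CommRing K] [NonUnitalRing A] [Module K A]

/-- The congruence on the (not necessarily unital) `K`-algebra `A` generated by the relations
`a = b` for `r a b`; it is closed under scalars because all scalar multiples of the relations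
are included. -/
def algConGen (r : A → A → Prop) : RingCon A :=
  ringConGen fun x y => ∃ (k : K) (a b : A), r a b ∧ x = k • a ∧ y = k • b

theorem algConGen_smul [IsScalarTower K A A] (r : A → A → Prop) (k : K) {x y : A} (h : algConGen K r x y) :
    algConGen K r (k • x) (k • y) := by
  change RingConGen.Rel _ x y at h
  change RingConGen.Rel _ (k • x) (k • y)
  induction h with
  | of x y h =>
    obtain ⟨c, a, b, hr, rfl, rfl⟩ := h
    exact .of _ _ ⟨k * c, a, b, hr, (mul_smul k c a).symm, (mul_smul k c b).symm⟩
  | refl x => exact .refl _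
  | symm _ ih => exact .symm ih
  | trans _ _ ih₁ ih₂ => exact .trans ih₁ ih₂
  | add _ _ ih₁ ih₂ => rw [smul_add, smul_add]; exact .add ih₁ ih₂
  | mul _ h₂ ih₁ _ => rw [← smul_mul_assoc, ← smul_mul_assoc]; exact .mul ih₁ h₂

/-- The quotient of the `K`-algebra `A` by the ideal generated by the relations `r`. -/
def AlgQuot (r : A → A → Prop) : Type _ := (algConGen K r).Quotient

namespace AlgQuot

variable (r : A → A → Prop)

instance : NonUnitalRing (AlgQuot K r) := inferInstanceAs (NonUnitalRing (algConGen K r).Quotient)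

/-- The quotient map. -/
def mk (a : A) : AlgQuot K r := RingCon.toQuotient (c := algConGen K r) a

theorem mk_surjective : Function.Surjective (mk K r) := Quotient.mk''_surjective

/-- The quotient map as a homomorphism of additive groups. -/
def mkAddHom : A →+ AlgQuot K r where
  toFun := mk K r
  map_zero' := rfl
  map_add' _ _ := rfl

variable [IsScalarTower K A A]

instance : SMul K (AlgQuot K r) where
  smul k := Quotient.map' (k • ·) fun _ _ h => algConGen_smul K r k h

instance : Module K (AlgQuot K r) :=
  Function.Surjective.module K (mkAddHom K r) (mk_surjective K r) fun _ _ => rfl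

instance : IsScalarTower K (AlgQuot K r) (AlgQuot K r) where
  smul_assoc k x y := by
    obtain ⟨a, rfl⟩ := mk_surjective K r x
    obtain ⟨b, rfl⟩ := mk_surjective K r y
    exact congrArg (mk K r) (smul_mul_assoc k a b)

instance [SMulCommClass K A A] : SMulCommClass K (AlgQuot K r) (AlgQuot K r) where
  smul_comm k x y := by
    obtain ⟨a, rfl⟩ := mk_surjective K r x
    obtain ⟨b, rfl⟩ := mk_surjective K r y
    exact congrArg (mk K r) (mul_smul_comm k a b).symm

end AlgQuot

end Quotient

/-- The free (not necessarily unital) associative `K`-algebra on `X`. -/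
abbrev FreeNUAlgebra (K X : Type*) [CommRing K] : Type _ := MonoidAlgebra K (FreeSemigroup X)

/-- The generator of the free algebra that corresponds to `x`. -/
noncomputable def FreeNUAlgebra.gen (K : Type*) {X : Type*} [CommRing K] (x : X) :
    FreeNUAlgebra K X :=
  MonoidAlgebra.single (FreeSemigroup.of x) 1

open Classical in
/-- The defining relations of the path algebra of a directed graph. -/
inductive DirGraph.PathAlgRel (K : Type*) [CommRing K] {V E : Type*} (G : DirGraph V E) :
    FreeNUAlgebra K (V ⊕ E) → FreeNUAlgebra K (V ⊕ E) → Prop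
  | vertex (u v : V) : PathAlgRel K G
      (FreeNUAlgebra.gen K (Sum.inl u) * FreeNUAlgebra.gen K (Sum.inl v))
      (if u = v then FreeNUAlgebra.gen K (Sum.inl u) else 0)
  | src (e : E) : PathAlgRel K G
      (FreeNUAlgebra.gen K (Sum.inl (G.src e)) * FreeNUAlgebra.gen K (Sum.inr e))
      (FreeNUAlgebra.gen K (Sum.inr e))
  | rng (e : E) : PathAlgRel K G
      (FreeNUAlgebra.gen K (Sum.inr e) * FreeNUAlgebra.gen K (Sum.inl (G.rng e)))
      (FreeNUAlgebra.gen K (Sum.inr e))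

/-! ### Weighted graphs and weighted Leavitt path algebras -/

/-- A weighted graph: a directed graph with a positive integer weight on each edge. -/
structure WeightedGraph (V E : Type*) extends DirGraph V E where
  weight : E → ℕ
  weight_pos : ∀ e, 0 < weight e

namespace WeightedGraph

variable {V E : Type*}

/-- The edges `e_1, …, e_{w(e)}` of the associated directed graph; the edge `e_i` is
`⟨e, i - 1⟩`, i.e. indices are shifted to start at `0`. -/
abbrev HatEdge (G : WeightedGraph V E) : Type _ := Σ e : E, Fin (G.weight e)

/-- The directed graph associated to a weighted graph. -/
def hat (G : WeightedGraph V E) : DirGraph V G.HatEdge where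
  src x := G.src x.1
  rng x := G.rng x.1

/-- The real (`Sum.inl`) and ghost (`Sum.inr`) edges of the double graph of `G.hat`. -/
abbrev DEdge (G : WeightedGraph V E) : Type _ := G.HatEdge ⊕ G.HatEdge

/-- The alphabet of vertices, real edges and ghost edges. -/
abbrev Letter (G : WeightedGraph V E) : Type _ := V ⊕ G.DEdge

/-- A vertex is regular if it emits an edge. -/
def IsRegular (G : WeightedGraph V E) (v : V) : Prop := ∃ e, G.src e = v

open Classical in
/-- The finite set of edges emitted by `v`. -/
noncomputable def emitted [Fintype E] (G : WeightedGraph V E) (v : V) : Finset E :=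
  Finset.univ.filter fun e => G.src e = v

/-- The weight of a vertex: the maximal weight of an edge that it emits. -/
noncomputable def vertexWeight [Fintype E] (G : WeightedGraph V E) (v : V) : ℕ :=
  (G.emitted v).sup G.weight

section Algebra

variable (K : Type*) [CommRing K] (G : WeightedGraph V E)

/-- The real edge `e_{i+1}` in the free algebra, `0` if `i + 1 > w(e)`. -/
noncomputable def realElt (e : E) (i : ℕ) : FreeNUAlgebra K G.Letter :=
  if h : i < G.weight e then FreeNUAlgebra.gen K (Sum.inr (Sum.inl ⟨e, i, h⟩)) else 0

/-- The ghost edge `e_{i+1}*` in the free algebra, `0` if `i + 1 > w(e)`. -/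
noncomputable def ghostElt (e : E) (i : ℕ) : FreeNUAlgebra K G.Letter :=
  if h : i < G.weight e then FreeNUAlgebra.gen K (Sum.inr (Sum.inr ⟨e, i, h⟩)) else 0

open Classical in
/-- The defining relations of the weighted Leavitt path algebra, on top of those of the path
algebra of the double graph of `G.hat`. -/
inductive LeavittRel [Fintype E] :
    FreeNUAlgebra K G.Letter → FreeNUAlgebra K G.Letter → Prop
  | path {a b : FreeNUAlgebra K G.Letter} (h : G.hat.double.PathAlgRel K a b) : LeavittRel a b
  | real_ghost (v : V) (hv : G.IsRegular v) (i j : ℕ)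
      (hi : i < G.vertexWeight v) (hj : j < G.vertexWeight v) :
      LeavittRel (∑ e ∈ G.emitted v, G.realElt K e i * G.ghostElt K e j)
        (if i = j then FreeNUAlgebra.gen K (Sum.inl v) else 0)
  | ghost_real (v : V) (hv : G.IsRegular v) (e f : E) (he : G.src e = v) (hf : G.src f = v) :
      LeavittRel (∑ i ∈ Finset.range (G.vertexWeight v), G.ghostElt K e i * G.realElt K f i)
        (if e = f then FreeNUAlgebra.gen K (Sum.inl (G.rng e)) else 0)

/-- The weighted Leavitt path algebra `L_K(E,w)`, as a not necessarily unital `K`-algebra. -/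
abbrev LeavittPathAlgebra [Fintype E] : Type _ := AlgQuot K (G.LeavittRel K)

end Algebra

/-! ### Nod-paths and quasi-cycles -/

/-- A choice of an edge `e^v` of maximal weight emitted by `v`, for every regular vertex `v`. -/
structure SpecialEdges [Fintype E] (G : WeightedGraph V E) where
  edge : ∀ v, G.IsRegular v → E
  src_edge : ∀ v hv, G.src (edge v hv) = v
  weight_edge : ∀ v hv, G.weight (edge v hv) = G.vertexWeight v

variable [Fintype E] {G : WeightedGraph V E} (c : G.SpecialEdges)

/-- The forbidden words `e^v_i (e^v_j)*` and `e_1* f_1` with `e`, `f` emitted by one vertex. -/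
inductive Forbidden : List G.Letter → Prop
  | real_ghost (v : V) (hv : G.IsRegular v) (i j : Fin (G.weight (c.edge v hv))) :
      Forbidden [Sum.inr (Sum.inl ⟨c.edge v hv, i⟩), Sum.inr (Sum.inr ⟨c.edge v hv, j⟩)]
  | ghost_real (e f : E) (h : G.src e = G.src f) :
      Forbidden [Sum.inr (Sum.inr ⟨e, 0, G.weight_pos e⟩),
        Sum.inr (Sum.inl ⟨f, 0, G.weight_pos f⟩)]

/-- A nod-path: a path in the double graph of `G.hat` without forbidden subwords. -/
def IsNodPath (p : List G.Letter) : Prop :=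
  G.hat.double.IsPath p ∧ ∀ q, q <:+: p → ¬ Forbidden c q

/-- `p ⟹ q` through a nod-path `o` that does not have `p` as a prefix. -/
def NodConnects (p q : List G.Letter) : Prop :=
  ∃ o, IsNodPath c o ∧ ¬ p <+: o ∧ IsNodPath c (p ++ o ++ q)

/-- The relation `p ⟹ q`. -/
def Connects (p q : List G.Letter) : Prop :=
  IsNodPath c (p ++ q) ∨ NodConnects c p q

/-- A nod²-path: a nod-path whose square is a nod-path. -/
def IsNodSqPath (p : List G.Letter) : Prop :=
  IsNodPath c p ∧ IsNodPath c (p ++ p)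

/-- A quasi-cycle: a nod²-path `p` such that no subword of `p²` shorter than `p` is a
nod²-path. -/
def IsQuasiCycle (p : List G.Letter) : Prop :=
  IsNodSqPath c p ∧ ∀ q, q <:+: p ++ p → pathLength q < pathLength p → ¬ IsNodSqPath c q

/-- A selfconnected quasi-cycle. -/
def IsSelfconnected (p : List G.Letter) : Prop :=
  IsQuasiCycle c p ∧ NodConnects c p p

/-- A chain of quasi-cycles: consecutive members are related by `⟹`, and no two members are
cyclic rotations of each other. -/
def IsQuasiCycleChain (L : List (List G.Letter)) : Prop :=
  (∀ p ∈ L, IsQuasiCycle c p) ∧ L.Pairwise (fun p q => ¬ p.IsRotated q) ∧ L.IsChain (Connects c)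

end WeightedGraph

/-! ### Growth of algebras -/

section Growth

variable {K A : Type*} [Field K] [NonUnitalRing A] [Module K A]

/-- `V^n`: the span of all products of `k` elements of `V`, `1 ≤ k ≤ n`. -/
def growthSpace (V : Submodule K A) (n : ℕ) : Submodule K A :=
  Submodule.span K {a | ∃ v ∈ V, ∃ l : List A, (∀ x ∈ l, x ∈ V) ∧ l.length + 1 ≤ n ∧
    a = l.foldl (· * ·) v}

/-- `V` is a finite-dimensional subspace that generates the algebra. -/
def IsGeneratingSpace (V : Submodule K A) : Prop :=
  FiniteDimensional K V ∧ ∀ a : A, ∃ n, a ∈ growthSpace V n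

/-- `d_V(n) = dim V^n`. -/
noncomputable def growthFun (V : Submodule K A) (n : ℕ) : ℕ := Module.finrank K (growthSpace V n)

/-- `f ≼ g`: there is a positive integer `c` with `f(n) ≤ c g(cn)` for all `n ≥ 1`. -/
def AsympLE (f g : ℕ → ℝ) : Prop := ∃ c : ℕ, 1 ≤ c ∧ ∀ n, 1 ≤ n → f n ≤ c * g (c * n)

variable (K A)

/-- The algebra is finitely generated with `d_V ≼ n^m` for some `m`. -/
def HasPolynomialGrowth : Prop :=
  ∃ V : Submodule K A, IsGeneratingSpace V ∧
    ∃ m : ℕ, 1 ≤ m ∧ AsympLE (fun n => growthFun V n) (fun n => (n : ℝ) ^ m)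

/-- `GKdim A = d`: the algebra is finitely generated and `limsup log_n (dim V^n) = d` for every
finite-dimensional generating subspace `V`. -/
def IsGKDim (d : EReal) : Prop :=
  (∃ V : Submodule K A, IsGeneratingSpace V) ∧
    ∀ V : Submodule K A, IsGeneratingSpace V →
      Filter.limsup (fun n : ℕ => (Real.logb n (growthFun V n) : EReal)) Filter.atTop = d

end Growth

/-! ### Growth spaces -/

section GrowthSpace

variable {K A : Type*} [Field K] [NonUnitalRing A] [Module K A]

/-! Indices of edges start at 0 below. Each defining relation of `L_K(E,w)` can be solved for the
one forbidden word in it, and the nod-paths are the normal forms of the resulting rewriting system.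
They form a basis. For independence, the algebra acts on formal words: a letter is put in front of a
reduced word and rewritten at most once (`letterMul`). The relations hold for this action because
the two kinds of overlap of forbidden words, `e_i e_0* f_0` with `e` special and `e_0* f_0 f_j*`
with `f` special, resolve (`sum_real_ghost`, `sum_ghost_real`). The span of the nod-paths of length
at most 1 generates, and its n-th power is the span of the nod-paths of length at most n
(`growthSpace_wordSpan`). Its growth function therefore counts these paths for `n ≥ 1`, and another
generating space only rescales n linearly.

Every forbidden word has two letters. So nod-paths of positive length are the walks of a finite
directed graph whose vertices are the edges of the double graph (`NodRel`), and quasi-cycles are its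
minimal closed walks. What remains is to count walks.

If a minimal closed walk p is linked to itself through o, then `po ≠ op` by minimality, and the
equally long walks `ppo` and `pop` can be combined freely: growth is exponential
(`IsMinimalClosed.exists_exponential_of_links`).

If there is no such link, a vertex has at most one successor in its strongly connected component
(`NoSelfLink.unique_successor`), so every component with a closed walk is a single cycle, and its
minimal closed walks are rotations of each other (`NoSelfLink.isRotated`). Chains of quasi-cycles
then amount to strictly descending chains of cyclic vertices, whose length is bounded. A walk
through d cycles may choose how often it turns in each of them, which gives order `n^d` walks from
below (`exists_many_walks`). Induction along the order of components gives the same order from above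
(`NoSelfLink.exists_walkCount_le`). -/

theorem growthSpace_mono (V : Submodule K A) {m n : ℕ} (h : m ≤ n) :
    growthSpace V m ≤ growthSpace V n := by
  refine Submodule.span_mono ?_
  rintro a ⟨v, hv, l, hl, hlen, rfl⟩
  exact ⟨v, hv, l, hl, hlen.trans h, rfl⟩

theorem le_growthSpace (V : Submodule K A) {n : ℕ} (h : 1 ≤ n) : V ≤ growthSpace V n :=
  fun v hv => Submodule.subset_span ⟨v, hv, [], by simp, by simpa using h, rfl⟩

/-- Products are nested to the left, so induction on the last factor shows that the powers of `V`
form the smallest filtration that contains `V` in degree 1 and is stable under right multiplication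
by `V`. -/
theorem growthSpace_le {V : Submodule K A} (F : ℕ → Submodule K A) (hF : Monotone F)
    (h1 : V ≤ F 1) (hmul : ∀ n, ∀ a ∈ F n, ∀ b ∈ V, a * b ∈ F (n + 1)) (n : ℕ) :
    growthSpace V n ≤ F n := by
  refine Submodule.span_le.2 ?_
  rintro a ⟨v, hv, l, hl, hlen, rfl⟩
  refine hF hlen ?_
  clear hlen
  induction l using List.reverseRecOn with
  | nil => exact h1 hv
  | append_singleton l x ih =>
    rw [List.foldl_append, List.length_append]
    exact hmul _ _ (ih fun y hy => hl y (by simp [hy])) _ (hl x (by simp))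

/-- A finite spanning set of `V'` already lies in one power of `V`. With
`growthSpace_le_growthSpace_mul` this compares the growth of any two generating spaces up to a
linear change of n. -/
theorem IsGeneratingSpace.exists_le_growthSpace {V : Submodule K A} (hV : IsGeneratingSpace V)
    (V' : Submodule K A) [FiniteDimensional K V'] : ∃ c, 1 ≤ c ∧ V' ≤ growthSpace V c := by
  obtain ⟨S, rfl⟩ := (Module.Finite.iff_fg (N := V')).1 inferInstance
  choose f hf using hV.2
  refine ⟨S.sup f + 1, by omega, Submodule.span_le.2 fun a ha => ?_⟩
  exact growthSpace_mono V ((Finset.le_sup ha).trans (Nat.le_succ _)) (hf a)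

variable [IsScalarTower K A A] [SMulCommClass K A A]

theorem mul_mem_growthSpace (V : Submodule K A) {m n : ℕ} {a b : A} (ha : a ∈ growthSpace V m)
    (hb : b ∈ growthSpace V n) : a * b ∈ growthSpace V (m + n) := by
  induction ha using Submodule.span_induction with
  | zero => simp
  | add x y _ _ hx hy => rw [add_mul]; exact add_mem hx hy
  | smul k x _ hx => rw [smul_mul_assoc]; exact Submodule.smul_mem _ _ hx
  | mem x hx =>
    obtain ⟨v, hv, l, hl, hlen, rfl⟩ := hx
    induction hb using Submodule.span_induction with
    | zero => simp
    | add x y _ _ hx hy => rw [mul_add]; exact add_mem hx hy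
    | smul k x _ hx => rw [mul_smul_comm]; exact Submodule.smul_mem _ _ hx
    | mem y hy =>
      obtain ⟨v', hv', l', hl', hlen', rfl⟩ := hy
      refine Submodule.subset_span ⟨v, hv, l ++ v' :: l', ?_, ?_, ?_⟩
      · intro x hx
        simp only [List.mem_append, List.mem_cons] at hx
        rcases hx with hx | rfl | hx
        exacts [hl x hx, hv', hl' x hx]
      · simp only [List.length_append, List.length_cons]; omega
      · rw [List.foldl_append, List.foldl_cons, List.foldl_assoc]

theorem growthSpace_le_growthSpace_mul {V V' : Submodule K A} {c : ℕ}
    (h : V' ≤ growthSpace V c) (n : ℕ) : growthSpace V' n ≤ growthSpace V (c * n) := by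
  refine growthSpace_le (fun n => growthSpace V (c * n))
    (fun m n hmn => growthSpace_mono V (Nat.mul_le_mul_left c hmn)) (by simpa using h) ?_ n
  intro n a ha b hb
  rw [Nat.mul_succ]
  exact mul_mem_growthSpace V ha (h hb)

end GrowthSpace

/-! ### Walks in a directed graph given by a relation -/

namespace RelWalk

open Relation

variable {D : Type*} (R : D → D → Prop)

/-- A nonempty walk whose last vertex is related to its first one. -/
def IsClosed (l : List D) : Prop := l ≠ [] ∧ (l ++ l).IsChain R

/-- A closed walk whose square has no shorter closed subwalk. -/
def IsMinimalClosed (l : List D) : Prop :=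
  IsClosed R l ∧ ∀ q, q <:+: l ++ l → q.length < l.length → ¬ IsClosed R q

/-- A walk leads from `p` to `q` without going around `p` first. -/
def Links (p q : List D) : Prop := ∃ o, o ≠ [] ∧ ¬ p <+: o ∧ (p ++ o ++ q).IsChain R

/-- No minimal closed walk can be left and reached again. -/
def NoSelfLink : Prop := ∀ p, IsMinimalClosed R p → ¬ Links R p p

/-- `y` can be reached from `x` but not conversely. -/
def Below (x y : D) : Prop := ReflTransGen R x y ∧ ¬ ReflTransGen R y x

/-- A chain of pairwise non-rotated minimal closed walks. -/
def IsMinimalClosedChain (L : List (List D)) : Prop :=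
  (∀ p ∈ L, IsMinimalClosed R p) ∧ L.Pairwise (fun p q => ¬ p.IsRotated q) ∧
    L.IsChain (fun p q => (p ++ q).IsChain R ∨ Links R p q)

variable {R}

/-! ### Gluing, closing up and repeating walks -/

theorem pairwise_reflTransGen {l : List D} (h : l.IsChain R) : l.Pairwise (ReflTransGen R) :=
  List.isChain_iff_pairwise.1 (h.imp fun _ _ => ReflTransGen.single)

theorem reflTransGen_of_mem {p q : List D} (h : (p ++ q).IsChain R) {x y : D} (hx : x ∈ p)
    (hy : y ∈ q) : ReflTransGen R x y :=
  (List.pairwise_append.1 (pairwise_reflTransGen h)).2.2 x hx y hy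

theorem IsClosed.transGen {p : List D} (h : IsClosed R p) {x : D} (hx : x ∈ p) :
    TransGen R x x := by
  obtain ⟨s, t, rfl⟩ := List.append_of_mem hx
  have h2 := h.2
  rw [List.append_assoc] at h2
  have h3 : (x :: (t ++ (s ++ x :: t))).IsChain R := by simpa using h2.right_of_append
  have h4 : (x :: (t ++ (s ++ x :: t))).IsChain (TransGen R) :=
    h3.imp fun _ _ => TransGen.single
  exact List.rel_of_pairwise_cons (List.isChain_iff_pairwise.1 h4) (by simp)

/-- Being a walk is a condition on adjacent letters only, so walks can be glued along any nonempty
overlap. This is the basic tool for the composite walks below. -/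
theorem isChain_of_overlap {a b c : List D} (h₁ : (a ++ b).IsChain R) (h₂ : (b ++ c).IsChain R)
    (hb : b ≠ []) : (a ++ (b ++ c)).IsChain R := by
  rw [← List.append_assoc]; exact h₁.append_overlap h₂ hb

/-- Here `o` is a walk from `x` to `y` without its last vertex; it may be empty if `x = y`. The last
conclusion records that `x` is the letter that follows `p`. -/
theorem exists_walk {x y : D} (h : ReflTransGen R x y) {p q : List D}
    (hp : (p ++ [x]).IsChain R) (hq : (y :: q).IsChain R) :
    ∃ o, (p ++ o ++ y :: q).IsChain R ∧ (∃ r, x :: r = o ++ y :: q) := by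
  obtain ⟨l, hl, hlast⟩ := List.exists_isChain_cons_of_relationReflTransGen h
  have hne : x :: l ≠ [] := by simp
  have e : (x :: l).dropLast ++ [y] = x :: l := by
    rw [← hlast]; exact List.dropLast_append_getLast hne
  have h1 : (p ++ x :: l).IsChain R := isChain_of_overlap (b := [x]) hp hl (by simp)
  refine ⟨(x :: l).dropLast, ?_, l ++ q, ?_⟩
  · rw [← e, ← List.append_assoc] at h1
    simpa using h1.append_overlap (l₃ := q) hq (by simp)
  · rw [← List.cons_append, ← e]; simp

/-- From its end a closed walk can go on to its first vertex, hence to everything that is reachable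
from any of its vertices. -/
theorem exists_link {p q : List D} (hp : IsClosed R p) (hq : q.IsChain R) {x y : D}
    (hx : x ∈ p) (hy : y ∈ q.head?) (h : ReflTransGen R x y) :
    ∃ o, (p ++ o ++ q).IsChain R := by
  obtain ⟨q', rfl⟩ := List.head?_eq_some_iff.1 hy
  match p, hp with
  | c :: p', hp =>
    have h' : ReflTransGen R c y := (reflTransGen_of_mem hp.2 (by simp) hx).trans h
    obtain ⟨o, ho, -⟩ := exists_walk h' (p := c :: p') (q := q')
      (hp.2.prefix ⟨p', by simp⟩) hq
    exact ⟨o, ho⟩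

theorem isChain_flatten_replicate {w r : List D} (hw : w ≠ []) (h : (w ++ w).IsChain R)
    (hr : (w ++ r).IsChain R) (a : ℕ) :
    ((List.replicate (a + 1) w).flatten ++ r).IsChain R := by
  induction a with
  | zero => simpa using hr
  | succ a ih =>
    rw [List.replicate_succ, List.flatten_cons, List.append_assoc]
    rw [List.replicate_succ, List.flatten_cons, List.append_assoc] at ih ⊢
    exact isChain_of_overlap h ih hw

/-- Take a shortest closed walk inside the strongly connected component of `x`. A subwalk of its
square uses the same vertices, so it competes in the same minimum. -/
theorem exists_isMinimalClosed {x : D} (hx : TransGen R x x) :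
    ∃ p, IsMinimalClosed R p ∧ ∀ z ∈ p, ReflTransGen R x z ∧ ReflTransGen R z x := by
  have hex : ∃ n p, IsClosed R p ∧ (∀ z ∈ p, ReflTransGen R x z ∧ ReflTransGen R z x) ∧
      p.length = n := by
    obtain ⟨y, hxy, hyx⟩ := TransGen.head'_iff.1 hx
    obtain ⟨l, hl, hlast⟩ := List.exists_isChain_cons_of_relationReflTransGen hyx
    have hcl : IsClosed R (y :: l) := by
      refine ⟨by simp, hl.append hl ?_⟩
      intro a ha b hb
      rw [List.getLast?_eq_some_getLast (by simp), hlast] at ha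
      simp only [List.head?_cons, Option.mem_def, Option.some.injEq] at ha hb
      exact ha ▸ hb ▸ hxy
    have hmem : x ∈ y :: l := hlast ▸ List.getLast_mem _
    exact ⟨_, _, hcl, fun z hz => ⟨reflTransGen_of_mem hcl.2 hmem hz,
      reflTransGen_of_mem hcl.2 hz hmem⟩, rfl⟩
  classical
  obtain ⟨p, hp, hpx, hlen⟩ := Nat.find_spec hex
  refine ⟨p, ⟨hp, fun q hq hlt hcl => ?_⟩, hpx⟩
  refine Nat.find_min hex (hlen ▸ hlt) ⟨q, hcl, fun z hz => hpx z ?_, rfl⟩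
  simpa using hq.subset hz

/-! #### Two walks that can be combined freely -/

/-- Blocks of equal length can be read off from a product, so distinct sequences of blocks give
distinct walks. The walks counted have `n` free blocks followed by a final `A`. -/
theorem exists_exponential {A B : List D} (hA : A ≠ []) (hlen : A.length = B.length)
    (hne : A ≠ B) (hAA : (A ++ A).IsChain R) (hAB : (A ++ B).IsChain R)
    (hBA : (B ++ A).IsChain R) (hBB : (B ++ B).IsChain R) (n : ℕ) :
    ∃ S : Finset (List D), S.card = 2 ^ n ∧
      ∀ l ∈ S, l ≠ [] ∧ l.IsChain R ∧ l.length ≤ A.length * (n + 1) := by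
  classical
  have hB : B ≠ [] := by
    rintro rfl
    exact hA (List.length_eq_zero_iff.1 hlen)
  -- The induction must remember which block comes first, since a further block is glued on along
  -- it.
  suffices h : ∃ S : Finset (List D), S.card = 2 ^ n ∧
      ∀ l ∈ S, (A <+: l ∨ B <+: l) ∧ l.IsChain R ∧ l.length ≤ A.length * (n + 1) by
    obtain ⟨S, h1, h2⟩ := h
    refine ⟨S, h1, fun l hl => ⟨?_, (h2 l hl).2⟩⟩
    rintro rfl
    rcases (h2 _ hl).1 with h | h
    exacts [hA (List.prefix_nil.1 h), hB (List.prefix_nil.1 h)]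
  induction n with
  | zero => exact ⟨{A}, by simp, by simpa using hAA.left_of_append⟩
  | succ n ih =>
    obtain ⟨S, hcard, hS⟩ := ih
    refine ⟨S.image (A ++ ·) ∪ S.image (B ++ ·), ?_, ?_⟩
    · rw [Finset.card_union_of_disjoint,
        Finset.card_image_of_injective _ (List.append_right_injective A),
        Finset.card_image_of_injective _ (List.append_right_injective B), hcard, pow_succ]
      · ring
      · rw [Finset.disjoint_left]
        intro l h1 h2
        obtain ⟨a, -, rfl⟩ := Finset.mem_image.1 h1
        obtain ⟨b, -, hb⟩ := Finset.mem_image.1 h2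
        exact hne (List.append_inj hb hlen.symm).1.symm
    · intro l hl
      rw [Finset.mem_union, Finset.mem_image, Finset.mem_image] at hl
      rcases hl with ⟨t, ht, rfl⟩ | ⟨t, ht, rfl⟩
      · obtain ⟨h1, h2, h3⟩ := hS t ht
        refine ⟨.inl ⟨t, rfl⟩, ?_, ?_⟩
        · rcases h1 with ⟨r, rfl⟩ | ⟨r, rfl⟩
          exacts [isChain_of_overlap hAA h2 hA, isChain_of_overlap hAB h2 hB]
        · rw [List.length_append, Nat.mul_succ]; omega
      · obtain ⟨h1, h2, h3⟩ := hS t ht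
        refine ⟨.inr ⟨t, rfl⟩, ?_, ?_⟩
        · rcases h1 with ⟨r, rfl⟩ | ⟨r, rfl⟩
          exacts [isChain_of_overlap hBA h2 hA, isChain_of_overlap hBB h2 hB]
        · rw [List.length_append, Nat.mul_succ]; omega

/-- If `po = op`, then either `p` is a prefix of `o`, which a link excludes, or `o` is a proper
prefix of `p` with `oo` a walk, which minimality excludes. The blocks are `ppo` and `pop` rather
than `po` and `op`, because `oo` need not be a walk. -/
theorem IsMinimalClosed.exists_exponential_of_links {p : List D} (hp : IsMinimalClosed R p)
    (h : Links R p p) : ∃ m, ∀ n, ∃ S : Finset (List D), S.card = 2 ^ n ∧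
      ∀ l ∈ S, l ≠ [] ∧ l.IsChain R ∧ l.length ≤ m * (n + 1) := by
  obtain ⟨o, ho, hpo, hc⟩ := h
  have hpp := hp.1.2
  have hp0 := hp.1.1
  have c1 : (p ++ o).IsChain R := hc.left_of_append
  have c2 : (o ++ p).IsChain R := by
    rw [List.append_assoc] at hc; exact hc.right_of_append
  have hne : p ++ o ≠ o ++ p := by
    intro e
    rcases le_total p.length o.length with hle | hle
    · exact hpo (List.prefix_of_prefix_length_le ⟨o, rfl⟩ (e ▸ List.prefix_append o p) hle)
    · obtain ⟨t, rfl⟩ : o <+: p :=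
        List.prefix_of_prefix_length_le (List.prefix_append o p) (e ▸ List.prefix_append p o) hle
      have ht : t ≠ [] := by
        rintro rfl
        exact hpo (by simp)
      refine hp.2 o ⟨[], t ++ (o ++ t), by simp⟩ ?_ ⟨ho, ?_⟩
      · rw [List.length_append]; have := List.length_pos_iff.2 ht; omega
      · refine c2.prefix ⟨t, by simp⟩
  have hlen : (p ++ p ++ o).length = (p ++ o ++ p).length := by
    simp only [List.length_append]; omega
  refine ⟨(p ++ p ++ o).length, exists_exponential (A := p ++ p ++ o) (B := p ++ o ++ p)
    (by simp [hp0]) hlen (fun e => hne ?_) ?_ ?_ ?_ ?_⟩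
  · rw [List.append_assoc, List.append_assoc, List.append_cancel_left_eq] at e
    exact e
  all_goals
    simp only [List.append_assoc]
    repeat first
      | exact hpp
      | exact c1
      | exact c2
      | refine isChain_of_overlap hpp ?_ hp0
      | refine isChain_of_overlap c1 ?_ ho
      | refine isChain_of_overlap c2 ?_ hp0

/-! #### Consequences of the absence of self-links -/

/-- Without self-links a nonempty `o` must begin with `p`. Strip this copy and repeat; `n` only
bounds the length for the induction. -/
theorem NoSelfLink.eq_power (hR : NoSelfLink R) {p : List D} (hp : IsMinimalClosed R p)
    (n : ℕ) (o : List D) (hn : o.length ≤ n) (ho : (p ++ o ++ p).IsChain R) :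
    ∃ a, o = (List.replicate a p).flatten := by
  induction n generalizing o with
  | zero => exact ⟨0, by simpa using hn⟩
  | succ n ih =>
    by_cases h0 : o = []
    · exact ⟨0, by simpa using h0⟩
    have hpo : p <+: o := by
      by_contra h
      exact hR p hp ⟨o, h0, h, ho⟩
    obtain ⟨t, rfl⟩ := hpo
    have hlen := List.length_pos_iff.2 hp.1.1
    obtain ⟨a, rfl⟩ := ih t (by rw [List.length_append] at hn; omega)
      (ho.suffix ⟨p, by simp⟩)
    exact ⟨a + 1, by simp [List.replicate_succ]⟩

theorem flatten_replicate_prefix (p : List D) {a b : ℕ} (h : a ≤ b) :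
    (List.replicate a p).flatten <+: (List.replicate b p).flatten := by
  obtain ⟨k, rfl⟩ := Nat.exists_eq_add_of_le h
  rw [List.replicate_add, List.flatten_append]
  exact List.prefix_append _ _

/-- Lead a minimal closed walk `p` of the component to `x`, then step to `y` or to `z`, and return
to `p`. Both round trips are powers of `p` by `eq_power`, so one is a prefix of the other, and `y`
and `z` stand at the same position. -/
theorem NoSelfLink.unique_successor (hR : NoSelfLink R) {x y z : D} (hy : R x y) (hz : R x z)
    (hyx : ReflTransGen R y x) (hzx : ReflTransGen R z x) : y = z := by
  obtain ⟨p, hp, hpx⟩ := exists_isMinimalClosed (TransGen.head' hy hyx)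
  obtain ⟨h, p', rfl⟩ := List.exists_cons_of_ne_nil hp.1.1
  obtain ⟨hxh, hhx⟩ := hpx h (by simp)
  obtain ⟨s, hs⟩ := exists_link hp.1 (List.isChain_singleton x) (x := h) (y := x)
    (by simp) (by simp) hhx
  have key : ∀ y, R x y → ReflTransGen R y x → ∃ r a,
      s ++ x :: y :: r = (List.replicate a (h :: p')).flatten := by
    intro y hy hyx
    -- The walk ends with two copies of `p`; the second one serves as the closing `p` in `eq_power`.
    obtain ⟨o, ho, r, hr⟩ := exists_walk (hyx.trans hxh) (p := [x])
      (q := p' ++ h :: p') (List.isChain_pair.2 hy) hp.1.2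
    have e : x :: y :: r = [x] ++ o ++ (h :: p') ++ (h :: p') := by simp [hr]
    obtain ⟨a, ha⟩ := hR.eq_power hp _ (s ++ ([x] ++ o ++ (h :: p'))) le_rfl (by
      have := isChain_of_overlap (c := o ++ (h :: p') ++ (h :: p')) hs
        (by simpa using ho) (by simp)
      simpa using this)
    refine ⟨r, a + 1, ?_⟩
    rw [List.replicate_add, List.flatten_append, ← ha, e]
    simp
  obtain ⟨r, a, hr⟩ := key y hy hyx
  obtain ⟨t, b, ht⟩ := key z hz hzx
  have aux : ∀ {y z : D} {r t : List D}, s ++ x :: y :: r <+: s ++ x :: z :: t → y = z := by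
    intro y z r t h
    rw [List.prefix_append_right_inj, List.cons_prefix_cons, List.cons_prefix_cons] at h
    exact h.2.1
  rcases le_total a b with hab | hab
  · exact aux (r := r) (t := t) (hr ▸ ht ▸ flatten_replicate_prefix _ hab)
  · exact (aux (r := t) (t := r) (hr ▸ ht ▸ flatten_replicate_prefix _ hab)).symm

/-- Inside one strongly connected component the walk is deterministic, so walks from the same vertex
differ only in length. -/
theorem NoSelfLink.prefix_or_prefix (hR : NoSelfLink R) {x c : D} {l m : List D}
    (hl : (x :: l).IsChain R) (hm : (x :: m).IsChain R) (hlc : ∀ z ∈ x :: l, ReflTransGen R z c)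
    (hmc : ∀ z ∈ x :: m, ReflTransGen R z c) (hcx : ReflTransGen R c x) :
    x :: l <+: x :: m ∨ x :: m <+: x :: l := by
  induction l generalizing x m with
  | nil => exact .inl (by simp)
  | cons y l ih =>
    match m with
    | [] => exact .inr (by simp)
    | z :: m =>
      rw [List.isChain_cons_cons] at hl hm
      obtain rfl : y = z := hR.unique_successor hl.1 hm.1 ((hlc y (by simp)).trans hcx)
        ((hmc z (by simp)).trans hcx)
      simp only [List.cons_prefix_cons, true_and] at ih ⊢
      exact ih hl.2 hm.2 (fun w hw => hlc w (List.mem_cons_of_mem _ hw))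
        (fun w hw => hmc w (List.mem_cons_of_mem _ hw)) (hcx.tail hl.1)

/-- A round trip from `p` through `q` and back is a power of `p`, so the first vertex `c` of `q`
lies on `p`. The rotation of `p` that starts at `c` and the walk `q` are then prefix-comparable, and
minimality of both forbids different lengths. -/
theorem NoSelfLink.isRotated (hR : NoSelfLink R) {p q : List D} (hp : IsMinimalClosed R p)
    (hq : IsMinimalClosed R q) {x y : D} (hx : x ∈ p) (hy : y ∈ q) (hxy : ReflTransGen R x y)
    (hyx : ReflTransGen R y x) : p.IsRotated q := by
  obtain ⟨c, q', rfl⟩ := List.exists_cons_of_ne_nil hq.1.1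
  obtain ⟨h, p', rfl⟩ := List.exists_cons_of_ne_nil hp.1.1
  have hxc : ReflTransGen R x c := hxy.trans (reflTransGen_of_mem hq.1.2 hy (by simp))
  have hyh : ReflTransGen R y h := hyx.trans (reflTransGen_of_mem hp.1.2 hx (by simp))
  obtain ⟨s, hs⟩ := exists_link hp.1 hq.1.2.left_of_append hx (by simp) hxc
  obtain ⟨t, ht⟩ := exists_link hq.1 hp.1.2.left_of_append hy (by simp) hyh
  obtain ⟨a, ha⟩ := hR.eq_power hp _ (s ++ (c :: q') ++ t) le_rfl (by
    have := isChain_of_overlap (c := t ++ (h :: p')) hs (by simpa using ht) (by simp)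
    simpa using this)
  have hc : c ∈ h :: p' := by
    have : c ∈ (List.replicate a (h :: p')).flatten := by rw [← ha]; simp
    obtain ⟨l, hl, hcl⟩ := List.mem_flatten.1 this
    rwa [List.eq_of_mem_replicate hl] at hcl
  generalize h :: p' = p at *
  obtain ⟨u, v, rfl⟩ := List.append_of_mem hc
  have hinf : c :: (v ++ u) <:+: (u ++ c :: v) ++ (u ++ c :: v) := ⟨u, c :: v, by simp⟩
  have hclosed : IsClosed R (c :: (v ++ u)) := by
    refine ⟨by simp, ?_⟩
    have h3 := isChain_of_overlap (c := u ++ c :: v) hp.1.2 hp.1.2 (by simp)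
    exact h3.infix ⟨u, c :: v, by simp⟩
  have hlen : (u ++ c :: v).length = (c :: (v ++ u)).length := by
    simp only [List.length_append, List.length_cons]; omega
  have hrot : (u ++ c :: v).IsRotated (c :: (v ++ u)) :=
    List.isRotated_append (l := u) (l' := c :: v)
  suffices c :: (v ++ u) = c :: q' by rwa [this] at hrot
  rcases hR.prefix_or_prefix (x := c) (c := c) hclosed.2.left_of_append hq.1.2.left_of_append
      (fun z hz => reflTransGen_of_mem hclosed.2 hz (by simp))
      (fun z hz => reflTransGen_of_mem hq.1.2 hz (by simp)) .refl with h | h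
  · refine h.eq_of_length_le (not_lt.1 fun hlt => hq.2 _ ?_ hlt hclosed)
    exact h.isInfix.trans (List.prefix_append _ _).isInfix
  · refine (h.eq_of_length_le (not_lt.1 fun hlt => hp.2 _ ?_ (hlen ▸ hlt) hq.1)).symm
    exact h.isInfix.trans hinf

/-! #### Chains of minimal closed walks and chains of vertices -/

/-- Choose one vertex on each walk. A way back between neighbours would put both in one component
and make them rotations of each other. -/
theorem NoSelfLink.exists_below_chain (hR : NoSelfLink R) {L : List (List D)}
    (hL : IsMinimalClosedChain R L) :
    ∃ L' : List D, L'.length = L.length ∧ (∀ x ∈ L', TransGen R x x) ∧ L'.IsChain (Below R) := by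
  have hex : ∀ p : List D, p ∈ L → ∃ x, x ∈ p := fun p hp =>
    List.exists_mem_of_ne_nil p (hL.1 p hp).1.1
  choose f hf using hex
  refine ⟨L.pmap f fun _ h => h, by simp, ?_, ?_⟩
  · intro x hx
    obtain ⟨p, hp, rfl⟩ := List.mem_pmap.1 hx
    exact (hL.1 p hp).1.transGen (hf p hp)
  · rw [List.isChain_pmap]
    have h1 := hL.2.1.isChain
    have h2 := hL.2.2
    rw [List.isChain_iff_getElem] at h1 h2 ⊢
    intro i hi
    refine ⟨List.getElem_mem _, List.getElem_mem _, ?_⟩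
    have hpi := hL.1 L[i] (List.getElem_mem _)
    have hqi := hL.1 L[i + 1] (List.getElem_mem _)
    have hreach :
        ReflTransGen R (f L[i] (List.getElem_mem _)) (f L[i + 1] (List.getElem_mem _)) := by
      rcases h2 i hi with h | ⟨o, -, -, h⟩
      · exact reflTransGen_of_mem h (hf _ _) (hf _ _)
      · exact reflTransGen_of_mem h (List.mem_append_left _ (hf _ _)) (hf _ _)
    exact ⟨hreach, fun hback => h1 i hi (hR.isRotated hpi hqi (hf _ _) (hf _ _) hreach hback)⟩

/-- Choose the connecting word `o` as short as possible. If it began with `p`, dropping that copy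
would give a shorter one. -/
theorem links_or_isChain_of_reach {p q : List D} (hp : IsClosed R p) (hq : IsClosed R q)
    {x y : D} (hx : x ∈ p) (hy : y ∈ q) (h : ReflTransGen R x y) :
    (p ++ q).IsChain R ∨ Links R p q := by
  classical
  obtain ⟨c, hc⟩ : ∃ c, c ∈ q.head? := by
    cases q with
    | nil => simp at hy
    | cons c q => exact ⟨c, by simp⟩
  have hcq : c ∈ q := List.mem_of_mem_head? hc
  have hex : ∃ n o, (p ++ o ++ q).IsChain R ∧ o.length = n := by
    obtain ⟨o, ho⟩ := exists_link hp hq.2.left_of_append hx hc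
      (h.trans (reflTransGen_of_mem hq.2 hy hcq))
    exact ⟨_, o, ho, rfl⟩
  obtain ⟨o, ho, hlen⟩ := Nat.find_spec hex
  by_cases h0 : o = []
  · subst h0
    exact .inl (by simpa using ho)
  refine .inr ⟨o, h0, ?_, ho⟩
  rintro ⟨t, rfl⟩
  refine Nat.find_min hex (m := t.length) ?_ ⟨t, ho.suffix ⟨p, by simp⟩, rfl⟩
  have := List.length_pos_iff.2 hp.1
  rw [← hlen, List.length_append]; omega

instance : IsTrans D (Below R) :=
  ⟨fun _ _ _ h₁ h₂ => ⟨h₁.1.trans h₂.1, fun h => h₂.2 (h.trans h₁.1)⟩⟩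

/-- Pick a minimal closed walk in the component of each vertex. Rotations have the same vertices, so
two rotated members would allow a way back up the chain. -/
theorem exists_isMinimalClosedChain {L : List D} (hL : ∀ x ∈ L, TransGen R x x)
    (hb : L.IsChain (Below R)) : ∃ L', IsMinimalClosedChain R L' ∧ L'.length = L.length := by
  have hex : ∀ x ∈ L, ∃ p, IsMinimalClosed R p ∧
      ∀ z ∈ p, ReflTransGen R x z ∧ ReflTransGen R z x :=
    fun x hx => exists_isMinimalClosed (hL x hx)
  choose f hf hfx using hex
  refine ⟨L.pmap f fun _ h => h, ⟨?_, ?_, ?_⟩, by simp⟩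
  · intro p hp
    obtain ⟨x, hx, rfl⟩ := List.mem_pmap.1 hp
    exact hf x hx
  · rw [List.pairwise_pmap]
    refine (List.isChain_iff_pairwise.1 hb).imp ?_
    intro x y hxy hx hy hrot
    obtain ⟨z, hz⟩ := List.exists_mem_of_ne_nil _ (hf x hx).1.1
    exact hxy.2 ((hfx y hy z (hrot.mem_iff.1 hz)).1.trans (hfx x hx z hz).2)
  · refine List.isChain_pmap_of_isChain ?_ hb _
    intro x y hx hy hxy
    obtain ⟨z, hz⟩ := List.exists_mem_of_ne_nil _ (hf x hx).1.1
    obtain ⟨w, hw⟩ := List.exists_mem_of_ne_nil _ (hf y hy).1.1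
    exact links_or_isChain_of_reach (hf x hx).1 (hf y hy).1 hz hw
      ((hfx x hx z hz).2.trans (hxy.1.trans (hfx y hy w hw).1))

theorem length_le_card_of_below_chain [Fintype D] {L : List D} (hb : L.IsChain (Below R)) :
    L.length ≤ Fintype.card D := by
  refine List.Nodup.length_le_card ?_
  exact (List.isChain_iff_pairwise.1 hb).imp fun h e => by subst e; exact h.2 .refl

/-! #### A lower bound for the number of walks -/

theorem exists_isClosed_cons {c : D} (hc : TransGen R c c) : ∃ w, IsClosed R (c :: w) := by
  obtain ⟨y, hcy, hyc⟩ := TransGen.head'_iff.1 hc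
  obtain ⟨o, ho, -⟩ := exists_walk hyc (p := [c]) (q := [])
    (List.isChain_pair.2 hcy) (List.isChain_singleton c)
  refine ⟨o, by simp, ?_⟩
  have h1 : ([c] ++ o ++ [c]).IsChain R := ho
  have h2 : ((c :: o) ++ ([c] ++ o)).IsChain R :=
    isChain_of_overlap (by simpa using h1) (by simpa using h1.left_of_append) (by simp)
  simpa using h2

/-- The walks are `w₁^{a₁} u₁ w₂^{a₂} u₂ ⋯` with fixed closed walks `wᵢ` at the members of the
chain, fixed connections `uᵢ`, and exponents chosen freely between 1 and `m`. -/
theorem exists_many_walks {c : D} {L : List D} (hL : ∀ x ∈ c :: L, TransGen R x x)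
    (hb : (c :: L).IsChain (Below R)) : ∃ A, ∀ m, 1 ≤ m → ∃ S : Finset (List D),
      m ^ (L.length + 1) ≤ S.card ∧ ∀ l ∈ S, (∃ l', l = c :: l') ∧ l.IsChain R ∧
        l.length ≤ A * m := by
  classical
  have hlenrep : ∀ (w : List D) a, (List.replicate a w).flatten.length = a * w.length := by
    intro w a; simp
  obtain ⟨w, hw⟩ := exists_isClosed_cons (hL c (by simp))
  induction L generalizing c w with
  | nil =>
    refine ⟨(c :: w).length, fun m hm => ⟨(Finset.range m).image fun a =>
      (List.replicate (a + 1) (c :: w)).flatten, ?_, ?_⟩⟩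
    · rw [Finset.card_image_of_injective]
      · simp
      · intro a b hab
        have := congrArg List.length hab
        simp only [hlenrep] at this
        exact Nat.succ_injective (Nat.eq_of_mul_eq_mul_right (by simp) this)
    · intro l hl
      obtain ⟨a, ha, rfl⟩ := Finset.mem_image.1 hl
      refine ⟨⟨_, by rw [List.replicate_succ, List.flatten_cons, List.cons_append]⟩, ?_, ?_⟩
      · have := isChain_flatten_replicate hw.1 hw.2 (r := [])
          (by simpa using hw.2.left_of_append) a
        simpa using this
      · rw [hlenrep, mul_comm]
        exact Nat.mul_le_mul_left _ (Finset.mem_range.1 ha)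
  | cons c' L ih =>
    rw [List.isChain_cons_cons] at hb
    obtain ⟨w', hw'⟩ := exists_isClosed_cons (hL c' (by simp))
    obtain ⟨A, hA⟩ := ih (fun x hx => hL x (List.mem_cons_of_mem _ hx)) hb.2 w' hw'
    obtain ⟨u, hu⟩ := exists_link hw (List.isChain_singleton c') (x := c) (by simp) (by simp)
      hb.1.1
    refine ⟨(c :: w).length + u.length + A, fun m hm => ?_⟩
    obtain ⟨S, hcard, hS⟩ := hA m hm
    have hcount : ∀ t ∈ S, t.count c = 0 := by
      intro t ht
      obtain ⟨⟨t', rfl⟩, htc, -⟩ := hS t ht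
      refine List.count_eq_zero.2 fun hmem => ?_
      rcases List.mem_cons.1 hmem with rfl | hmem
      · exact hb.1.2 .refl
      · exact hb.1.2 (List.rel_of_pairwise_cons (pairwise_reflTransGen htc) hmem)
    refine ⟨(Finset.range m ×ˢ S).image fun x =>
      (List.replicate (x.1 + 1) (c :: w)).flatten ++ (u ++ x.2), ?_, ?_⟩
    · rw [Finset.card_image_of_injOn, Finset.card_product, Finset.card_range, List.length_cons,
        pow_succ, mul_comm]
      · exact Nat.mul_le_mul_left _ hcard
      · rintro ⟨a, s⟩ ha ⟨b, t⟩ hb' hab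
        have hs := (Finset.mem_product.1 ha).2
        have ht := (Finset.mem_product.1 hb').2
        simp only at hab hs ht
        -- The tails never return to `c` and `u` contributes equally to both sides, so counting `c`
        -- recovers the exponent.
        have h1 := congrArg (List.count c) hab
        simp only [List.count_append, hcount s hs, hcount t ht, List.count_flatten,
          List.map_replicate, List.sum_replicate, smul_eq_mul] at h1
        have h2 : 0 < (c :: w).count c := List.count_pos_iff.2 (by simp)
        have h3 : a = b := by
          have : (a + 1) * (c :: w).count c = (b + 1) * (c :: w).count c := by omega
          exact Nat.succ_injective (Nat.eq_of_mul_eq_mul_right h2 this)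
        subst h3
        simpa using hab
    · intro l hl
      obtain ⟨⟨a, t⟩, hat, rfl⟩ := Finset.mem_image.1 hl
      obtain ⟨ha, ht⟩ := Finset.mem_product.1 hat
      obtain ⟨⟨t', rfl⟩, htc, htl⟩ := hS t ht
      refine ⟨⟨_, by rw [List.replicate_succ, List.flatten_cons, List.cons_append,
        List.cons_append]⟩, ?_, ?_⟩
      · refine isChain_flatten_replicate hw.1 hw.2 ?_ a
        have := isChain_of_overlap (c := t') hu htc (by simp)
        simpa using this
      · rw [List.length_append, List.length_append, hlenrep,
          add_mul (_ + _) A, add_mul (c :: w).length, ← add_assoc]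
        dsimp only
        have h1 : (a + 1) * (c :: w).length ≤ (c :: w).length * m := by
          rw [mul_comm]; exact Nat.mul_le_mul_left _ (Finset.mem_range.1 ha)
        have h2 : u.length ≤ u.length * m := Nat.le_mul_of_pos_right _ hm
        omega

/-! #### An upper bound for the number of walks -/

section Upper

variable [Fintype D]

open Classical in
variable (R) in
/-- The number of walks of at most `n` steps that start at `x`. -/
noncomputable def walkCount : ℕ → D → ℕ
  | 0, _ => 1
  | n + 1, x => 1 + ∑ y ∈ Finset.univ.filter (R x), walkCount n y

theorem ncard_walks_le (n : ℕ) (x : D) :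
    {l : List D | (x :: l).IsChain R ∧ l.length ≤ n}.ncard ≤ walkCount R n x := by
  classical
  induction n generalizing x with
  | zero =>
    have : {l : List D | (x :: l).IsChain R ∧ l.length ≤ 0} ⊆ {[]} := by
      rintro l ⟨-, hl⟩; simpa using hl
    exact (Set.ncard_le_ncard this).trans (by simp [walkCount])
  | succ n ih =>
    have hsub : {l : List D | (x :: l).IsChain R ∧ l.length ≤ n + 1} ⊆
        {[]} ∪ ⋃ y ∈ Finset.univ.filter (R x),
          (List.cons y) '' {l | (y :: l).IsChain R ∧ l.length ≤ n} := by
      rintro l ⟨hc, hl⟩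
      match l with
      | [] => simp
      | y :: l =>
        rw [List.isChain_cons_cons] at hc
        refine .inr (Set.mem_iUnion₂.2 ⟨y, by simpa using hc.1, l, ⟨hc.2, by simpa using hl⟩, rfl⟩)
    have hfin : ∀ y : D, {l : List D | (y :: l).IsChain R ∧ l.length ≤ n}.Finite := fun y =>
      (List.finite_length_le D n).subset fun l hl => hl.2
    have hfin2 : (⋃ y ∈ Finset.univ.filter (R x),
          (List.cons y) '' {l | (y :: l).IsChain R ∧ l.length ≤ n}).Finite :=
      Set.Finite.biUnion (Finset.finite_toSet _) fun y _ => (hfin y).image _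
    refine (Set.ncard_le_ncard hsub ((Set.finite_singleton _).union hfin2)).trans ?_
    refine (Set.ncard_union_le _ _).trans ?_
    rw [Set.ncard_singleton, walkCount]
    refine Nat.add_le_add_left ((Finset.set_ncard_biUnion_le _ _).trans ?_) 1
    exact Finset.sum_le_sum fun y _ => (Set.ncard_image_le (hfin y)).trans (ih y)

/-- Well-founded induction along `Below`. A cyclic vertex has at most one successor in its
component; the others lie strictly below and lose one cycle of the chain, so `f(n+1) ≤ 1 + f(n) + C
(n+1)^(d-1)`, which sums to order `n^d`. From a non-cyclic vertex every step goes strictly below,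
and only the constant grows. -/
theorem NoSelfLink.exists_walkCount_le (hR : NoSelfLink R) (x : D) (d : ℕ)
    (hd : ∀ L : List D, (∀ c ∈ L, TransGen R c c ∧ ReflTransGen R x c) →
      L.IsChain (Below R) → L.length ≤ d) :
    ∃ C, ∀ n, walkCount R n x ≤ C * (n + 1) ^ d := by
  classical
  have hwf : WellFounded (fun y x => Below R x y) := by
    have : IsTrans D (fun y x => Below R x y) := ⟨fun _ _ _ h₁ h₂ => _root_.trans h₂ h₁⟩
    have : Std.Irrefl (fun y x : D => Below R x y) := ⟨fun a h => h.2 .refl⟩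
    exact Finite.wellFounded_of_trans_of_irrefl _
  induction x using hwf.induction generalizing d with
  | _ x ih =>
  by_cases hx : TransGen R x x
  · obtain ⟨e, rfl⟩ : ∃ e, d = e + 1 := by
      have := hd [x] (by simpa using ⟨hx, .refl⟩) (List.isChain_singleton x)
      exact ⟨d - 1, by simp at this; omega⟩
    have hex : ∀ y, ∃ C, Below R x y → ∀ n, walkCount R n y ≤ C * (n + 1) ^ e := by
      intro y
      by_cases hxy : Below R x y
      · obtain ⟨C, hC⟩ := ih y hxy e (fun L hL hb => by
          have := hd (x :: L) (by
            intro c hc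
            rcases List.mem_cons.1 hc with rfl | hc
            exacts [⟨hx, .refl⟩, ⟨(hL c hc).1, hxy.1.trans (hL c hc).2⟩]) (hb.cons fun z hz => by
            have hz' := List.mem_of_mem_head? hz
            exact ⟨hxy.1.trans (hL z hz').2, fun h => hxy.2 ((hL z hz').2.trans h)⟩)
          simpa using this)
        exact ⟨C, fun _ => hC⟩
      · exact ⟨0, fun h => absurd h hxy⟩
    choose C hC using hex
    refine ⟨1 + ∑ y, C y, fun n => ?_⟩
    -- The successor inside the component is in general another vertex, so the bound is proved for
    -- the whole component at once, with one constant.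
    suffices h : ∀ z, ReflTransGen R x z → ReflTransGen R z x →
        walkCount R n z ≤ (1 + ∑ y, C y) * (n + 1) ^ (e + 1) from h x .refl .refl
    induction n with
    | zero => intro z _ _; simp [walkCount]
    | succ n ihn =>
      intro z hxz hzx
      rw [walkCount, ← Finset.sum_filter_add_sum_filter_not _ (fun y => ReflTransGen R y x)]
      have h1 : ∑ y ∈ (Finset.univ.filter (R z)).filter (fun y => ReflTransGen R y x),
          walkCount R n y ≤ (1 + ∑ y, C y) * (n + 1) ^ (e + 1) := by
        refine (Finset.sum_le_card_nsmul _ _ ((1 + ∑ y, C y) * (n + 1) ^ (e + 1)) ?_).trans ?_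
        · intro y hy
          simp only [Finset.mem_filter, Finset.mem_univ, true_and] at hy
          exact ihn y (hxz.tail hy.1) hy.2
        · rw [smul_eq_mul]
          refine (Nat.mul_le_mul_right _ (Finset.card_le_one.2 fun a ha b hb => ?_)).trans_eq
            (one_mul _)
          simp only [Finset.mem_filter, Finset.mem_univ, true_and] at ha hb
          exact hR.unique_successor ha.1 hb.1 (ha.2.trans hxz) (hb.2.trans hxz)
      have h2 : ∑ y ∈ (Finset.univ.filter (R z)).filter (fun y => ¬ ReflTransGen R y x),
          walkCount R n y ≤ (∑ y, C y) * (n + 1) ^ e := by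
        rw [Finset.sum_mul]
        refine (Finset.sum_le_sum fun y hy => ?_).trans
          (Finset.sum_le_sum_of_subset (Finset.subset_univ _))
        simp only [Finset.mem_filter, Finset.mem_univ, true_and] at hy
        exact hC y ⟨hxz.tail hy.1, hy.2⟩ n
      have h3 : 1 ≤ (n + 1) ^ e := Nat.one_le_pow _ _ (by omega)
      have h4 : (n + 1) ^ e ≤ (n + 2) ^ e := Nat.pow_le_pow_left (by omega) e
      generalize ∑ y, C y = c at *
      calc _ ≤ (n + 1) ^ e + ((1 + c) * (n + 1) ^ (e + 1) + c * (n + 1) ^ e) := by omega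
        _ = (1 + c) * ((n + 1) ^ e * (n + 2)) := by ring
        _ ≤ (1 + c) * ((n + 2) ^ e * (n + 2)) := by gcongr
        _ = _ := by ring
  · have hex : ∀ y, ∃ C, R x y → ∀ n, walkCount R n y ≤ C * (n + 1) ^ d := by
      intro y
      by_cases hxy : R x y
      · obtain ⟨C, hC⟩ := ih y ⟨.single hxy, fun h => hx (TransGen.head' hxy h)⟩ d
          fun L hL => hd L fun c hc => ⟨(hL c hc).1, ReflTransGen.head hxy (hL c hc).2⟩
        exact ⟨C, fun _ => hC⟩
      · exact ⟨0, fun h => absurd h hxy⟩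
    choose C hC using hex
    refine ⟨1 + ∑ y, C y, fun n => ?_⟩
    cases n with
    | zero => simp [walkCount]
    | succ n =>
      rw [walkCount]
      have h2 : ∑ y ∈ Finset.univ.filter (R x), walkCount R n y ≤ (∑ y, C y) * (n + 1) ^ d := by
        rw [Finset.sum_mul]
        refine (Finset.sum_le_sum fun y hy => ?_).trans
          (Finset.sum_le_sum_of_subset (Finset.subset_univ _))
        simp only [Finset.mem_filter, Finset.mem_univ, true_and] at hy
        exact hC y hy n
      have h3 : 1 ≤ (n + 1 + 1) ^ d := Nat.one_le_pow _ _ (by omega)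
      have h4 : (∑ y, C y) * (n + 1) ^ d ≤ (∑ y, C y) * (n + 1 + 1) ^ d := by gcongr; omega
      rw [add_mul, one_mul]
      omega

end Upper

end RelWalk

/-! ### Maps out of a quotient algebra -/

namespace AlgQuot

variable {K A B : Type*} [CommRing K] [NonUnitalRing A] [Module K A]
  [NonUnitalRing B] [Module K B] {r : A → A → Prop}

theorem map_eq_of_algConGen (f : A →ₙₐ[K] B) (h : ∀ a b, r a b → f a = f b) {x y : A}
    (hxy : algConGen K r x y) : f x = f y := by
  change RingConGen.Rel _ x y at hxy
  induction hxy with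
  | of x y hxy =>
    obtain ⟨c, a, b, hr, rfl, rfl⟩ := hxy
    rw [map_smul, map_smul, h a b hr]
  | refl x => rfl
  | symm _ ih => exact ih.symm
  | trans _ _ ih₁ ih₂ => exact ih₁.trans ih₂
  | add _ _ ih₁ ih₂ => rw [map_add, map_add, ih₁, ih₂]
  | mul _ _ ih₁ ih₂ => rw [map_mul, map_mul, ih₁, ih₂]

theorem mk_eq_of_rel {a b : A} (h : r a b) : mk K r a = mk K r b :=
  Quotient.sound' (RingConGen.Rel.of _ _ ⟨1, a, b, h, (one_smul K a).symm, (one_smul K b).symm⟩)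

theorem mk_mul (a b : A) : mk K r (a * b) = mk K r a * mk K r b := rfl

theorem mk_zero : mk K r 0 = 0 := rfl

theorem mk_sum {ι : Type*} (s : Finset ι) (f : ι → A) :
    mk K r (∑ i ∈ s, f i) = ∑ i ∈ s, mk K r (f i) := map_sum (mkAddHom K r) f s

variable [IsScalarTower K A A]

theorem mk_smul (k : K) (a : A) : mk K r (k • a) = k • mk K r a := rfl

/-- The linear map induced by an algebra homomorphism that respects the relations. -/
def liftLinear (f : A →ₙₐ[K] B) (h : ∀ a b, r a b → f a = f b) : AlgQuot K r →ₗ[K] B where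
  toFun := Quotient.lift f fun _ _ hxy => map_eq_of_algConGen f h hxy
  map_add' x y := by
    obtain ⟨a, rfl⟩ := mk_surjective K r x
    obtain ⟨b, rfl⟩ := mk_surjective K r y
    exact map_add f a b
  map_smul' k x := by
    obtain ⟨a, rfl⟩ := mk_surjective K r x
    exact map_smul f k a

end AlgQuot

/-! ### Reduced words -/

/-- The letters `e_i` and `e_i*` with an arbitrary index `i` (starting at `0`). -/
inductive IdxEdge (E : Type*)
  | real (e : E) (i : ℕ)
  | ghost (e : E) (i : ℕ)

namespace WeightedGraph

open IdxEdge

variable {V E : Type*}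

section Words

variable (G : WeightedGraph V E)

/-- The source of an indexed letter. -/
def idxSrc : IdxEdge E → V
  | real e _ => G.src e
  | ghost e _ => G.rng e

/-- The range of an indexed letter. -/
def idxRng : IdxEdge E → V
  | real e _ => G.rng e
  | ghost e _ => G.src e

/-- The index does not exceed the weight. -/
def InRange : IdxEdge E → Prop
  | real e i => i < G.weight e
  | ghost e i => i < G.weight e

/-- The source of the path that consists of the letters `l` and ends at the vertex `v`. -/
def wordSrc : List (IdxEdge E) → V → V
  | [], v => v
  | x :: _, _ => G.idxSrc x

end Words

/-- The vector space with basis the words `(l, v)`. -/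
abbrev WordSpace (K V E : Type*) [Field K] : Type _ := (List (IdxEdge E) × V) →₀ K

theorem end_ext {K : Type*} [Field K] {f g : Module.End K (WordSpace K V E)}
    (h : ∀ l v, f (Finsupp.single (l, v) 1) = g (Finsupp.single (l, v) 1)) : f = g := by
  ext1 ⟨l, v⟩
  exact LinearMap.ext_ring (h l v)

variable [Fintype E] {G : WeightedGraph V E} (c : G.SpecialEdges)

/-- The edge is one of the chosen edges of maximal weight. -/
def IsSpecial (e : E) : Prop := c.edge (G.src e) ⟨e, rfl⟩ = e

/-- The two letters form a forbidden word. -/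
def Clash : IdxEdge E → IdxEdge E → Prop
  | real e _, ghost f _ => e = f ∧ IsSpecial c e
  | ghost e i, real f j => i = 0 ∧ j = 0 ∧ G.src e = G.src f
  | _, _ => False

/-- The letters `l` form a nod-path that ends at `v`. -/
def Reduced : List (IdxEdge E) → V → Prop
  | [], _ => True
  | x :: l, v => G.InRange x ∧ G.idxRng x = G.wordSrc l v ∧ (∀ y ∈ l.head?, ¬ Clash c x y) ∧
      Reduced l v

theorem isSpecial_edge (v : V) (hv : G.IsRegular v) : IsSpecial c (c.edge v hv) := by
  have h : ∀ u (hu : G.IsRegular u), u = v → c.edge u hu = c.edge v hv := by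
    rintro u hu rfl; rfl
  exact h _ _ (c.src_edge v hv)

variable {c} in
theorem IsSpecial.eq {e f : E} (he : IsSpecial c e) (hf : IsSpecial c f)
    (h : G.src e = G.src f) : e = f := by
  have h' : ∀ u v (hu : G.IsRegular u) (hv : G.IsRegular v), u = v →
      c.edge u hu = c.edge v hv := by
    rintro u v hu hv rfl; rfl
  rw [← he, ← hf]
  exact h' _ _ _ _ h

variable {c} in
theorem IsSpecial.weight_eq {e : E} (he : IsSpecial c e) :
    G.weight e = G.vertexWeight (G.src e) := by
  conv_lhs => rw [← he]
  exact c.weight_edge _ _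

theorem mem_emitted {v : V} {e : E} : e ∈ G.emitted v ↔ G.src e = v := by
  classical
  simp [emitted]

theorem weight_le_vertexWeight (e : E) : G.weight e ≤ G.vertexWeight (G.src e) :=
  Finset.le_sup (f := G.weight) (mem_emitted.2 rfl)

variable {c} in
-- A leading ghost edge takes part in a clash with what follows only through its source and its
-- index. This and `real_congr` keep the correction terms of a rewriting step reduced.
theorem Reduced.ghost_congr {f g : E} {j : ℕ} {l : List (IdxEdge E)} {v : V}
    (h : Reduced c (ghost f j :: l) v) (hfg : G.src g = G.src f) (hj : j < G.weight g) :
    Reduced c (ghost g j :: l) v := by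
  refine ⟨hj, hfg.trans h.2.1, fun y hy hcl => h.2.2.1 y hy ?_, h.2.2.2⟩
  cases y with
  | real e i => exact ⟨hcl.1, hcl.2.1, hfg.symm.trans hcl.2.2⟩
  | ghost e i => exact hcl

variable {c} in
theorem Reduced.real_congr {f : E} {i k : ℕ} {l : List (IdxEdge E)} {v : V}
    (h : Reduced c (real f i :: l) v) (hk : k < G.weight f) :
    Reduced c (real f k :: l) v := by
  refine ⟨hk, h.2.1, fun y hy hcl => h.2.2.1 y hy ?_, h.2.2.2⟩
  cases y <;> exact hcl

/-! ### The representation on words -/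

section Rep

variable (K : Type*) [Field K]

open Classical in
/-- The basis vector of a reduced word, and `0` for other words. -/
noncomputable def wordVec (l : List (IdxEdge E)) (v : V) : WordSpace K V E :=
  if Reduced c l v then Finsupp.single (l, v) 1 else 0

open Classical in
/-- The product of a letter and a word, rewritten as a combination of reduced words. -/
noncomputable def letterMul : IdxEdge E → List (IdxEdge E) → V → WordSpace K V E
  | real e i, ghost f j :: l, v =>
    if Reduced c (ghost f j :: l) v ∧ e = f ∧ IsSpecial c e ∧ i < G.weight e then
      (if i = j then wordVec c K l v else 0) -
        ∑ g ∈ (G.emitted (G.src e)).erase e, wordVec c K (real g i :: ghost g j :: l) v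
    else wordVec c K (real e i :: ghost f j :: l) v
  | ghost e i, real f j :: l, v =>
    if Reduced c (real f j :: l) v ∧ i = 0 ∧ j = 0 ∧ G.src e = G.src f then
      (if e = f then wordVec c K l v else 0) -
        ∑ k ∈ Finset.Ico 1 (G.vertexWeight (G.src e)),
          wordVec c K (ghost e k :: real f k :: l) v
    else wordVec c K (ghost e i :: real f j :: l) v
  | x, l, v => wordVec c K (x :: l) v

/-- Left multiplication by a letter. -/
noncomputable def letterOp (x : IdxEdge E) : Module.End K (WordSpace K V E) :=
  Finsupp.linearCombination K fun p => letterMul c K x p.1 p.2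

open Classical in
/-- Left multiplication by a vertex. -/
noncomputable def vertexOp (u : V) : Module.End K (WordSpace K V E) :=
  Finsupp.linearCombination K fun p => if G.wordSrc p.1 p.2 = u then wordVec c K p.1 p.2 else 0

variable {K c}

theorem wordVec_of_reduced {l : List (IdxEdge E)} {v : V} (h : Reduced c l v) :
    wordVec c K l v = Finsupp.single (l, v) 1 := if_pos h

theorem wordVec_of_not_reduced {l : List (IdxEdge E)} {v : V} (h : ¬ Reduced c l v) :
    wordVec c K l v = 0 := if_neg h

theorem wordVec_cons_eq_zero {x : IdxEdge E} {l : List (IdxEdge E)} {v : V}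
    (h : ¬ Reduced c l v) : wordVec c K (x :: l) v = 0 :=
  wordVec_of_not_reduced fun h' => h h'.2.2.2

/-- The representation space contains all words, but the operators annihilate the non-reduced ones.
Hence operator identities need only be tested on `wordVec`, without side conditions. -/
theorem letterMul_of_not_reduced (x : IdxEdge E) {l : List (IdxEdge E)} {v : V}
    (h : ¬ Reduced c l v) : letterMul c K x l v = 0 := by
  match x, l with
  | real e i, ghost f j :: l => rw [letterMul, if_neg (fun h' => h h'.1), wordVec_cons_eq_zero h]
  | ghost e i, real f j :: l => rw [letterMul, if_neg (fun h' => h h'.1), wordVec_cons_eq_zero h]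
  | real e i, [] => exact wordVec_cons_eq_zero h
  | ghost e i, [] => exact wordVec_cons_eq_zero h
  | real e i, real f j :: l => exact wordVec_cons_eq_zero h
  | ghost e i, ghost f j :: l => exact wordVec_cons_eq_zero h

theorem letterOp_single (x : IdxEdge E) (l : List (IdxEdge E)) (v : V) :
    letterOp c K x (Finsupp.single (l, v) 1) = letterMul c K x l v := by
  simp [letterOp]

theorem letterOp_wordVec (x : IdxEdge E) (l : List (IdxEdge E)) (v : V) :
    letterOp c K x (wordVec c K l v) = letterMul c K x l v := by
  by_cases h : Reduced c l v
  · rw [wordVec_of_reduced h, letterOp_single]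
  · rw [wordVec_of_not_reduced h, map_zero, letterMul_of_not_reduced x h]

theorem letterMul_of_not_clash {x : IdxEdge E} {l : List (IdxEdge E)} {v : V}
    (h : ∀ y ∈ l.head?, ¬ Clash c x y) : letterMul c K x l v = wordVec c K (x :: l) v := by
  match x, l with
  | real e i, ghost f j :: l =>
    rw [letterMul, if_neg fun h' => h (ghost f j) (by simp) ⟨h'.2.1, h'.2.2.1⟩]
  | ghost e i, real f j :: l =>
    rw [letterMul, if_neg fun h' => h (real f j) (by simp) h'.2]
  | real e i, [] => rfl
  | ghost e i, [] => rfl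
  | real e i, real f j :: l => rfl
  | ghost e i, ghost f j :: l => rfl

theorem letterMul_real_ghost {e : E} {i j : ℕ} {l : List (IdxEdge E)} {v : V}
    (h : Reduced c (ghost e j :: l) v) (he : IsSpecial c e) (hi : i < G.weight e)
    [DecidableEq E] :
    letterMul c K (real e i) (ghost e j :: l) v = (if i = j then wordVec c K l v else 0) -
        ∑ g ∈ (G.emitted (G.src e)).erase e, wordVec c K (real g i :: ghost g j :: l) v := by
  rw [letterMul, if_pos ⟨h, rfl, he, hi⟩]
  congr!

theorem letterMul_ghost_real {e f : E} {l : List (IdxEdge E)} {v : V}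
    (h : Reduced c (real f 0 :: l) v) (hef : G.src e = G.src f) [DecidableEq E] :
    letterMul c K (ghost e 0) (real f 0 :: l) v = (if e = f then wordVec c K l v else 0) -
        ∑ k ∈ Finset.Ico 1 (G.vertexWeight (G.src e)),
          wordVec c K (ghost e k :: real f k :: l) v := by
  rw [letterMul, if_pos ⟨h, rfl, rfl, hef⟩]
  congr!

theorem letterMul_eq_zero_of_ne {x : IdxEdge E} {l : List (IdxEdge E)} {v : V}
    (h : G.idxRng x ≠ G.wordSrc l v) : letterMul c K x l v = 0 := by
  have h0 : wordVec c K (x :: l) v = 0 := wordVec_of_not_reduced fun h' => h h'.2.1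
  by_cases hcl : ∀ y ∈ l.head?, ¬ Clash c x y
  · rw [letterMul_of_not_clash hcl, h0]
  · exfalso
    push Not at hcl
    obtain ⟨y, hy, hcl⟩ := hcl
    obtain ⟨l, rfl⟩ := List.head?_eq_some_iff.1 hy
    match x, y, hcl with
    | real e i, ghost f j, hcl => exact h (by rw [← hcl.1]; rfl)
    | ghost e i, real f j, hcl => exact h hcl.2.2

theorem letterOp_eq_zero {x : IdxEdge E} (h : ¬ G.InRange x) : letterOp c K x = 0 := by
  ext1 ⟨l, v⟩
  refine LinearMap.ext_ring ?_
  rw [LinearMap.comp_apply, Finsupp.lsingle_apply, letterOp_single]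
  have h0 : wordVec c K (x :: l) v = 0 := wordVec_of_not_reduced fun h' => h h'.1
  rw [LinearMap.zero_comp, LinearMap.zero_apply]
  match x, l with
  | real e i, ghost f j :: l => rw [letterMul, if_neg (fun h' => h h'.2.2.2), h0]
  | ghost e i, real f j :: l =>
    rw [letterMul, if_neg (fun h' => h (by rw [h'.2.1]; exact G.weight_pos e)), h0]
  | real e i, [] => exact h0
  | ghost e i, [] => exact h0
  | real e i, real f j :: l => exact h0
  | ghost e i, ghost f j :: l => exact h0

open Classical in
theorem vertexOp_wordVec (u : V) (l : List (IdxEdge E)) (v : V) :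
    vertexOp c K u (wordVec c K l v) = if G.wordSrc l v = u then wordVec c K l v else 0 := by
  by_cases h : Reduced c l v
  · conv_lhs => rw [wordVec_of_reduced h]
    simp [vertexOp]
  · simp [wordVec_of_not_reduced h]

theorem letterOp_single_eq_wordVec (x : IdxEdge E) (l : List (IdxEdge E)) (v : V) :
    letterOp c K x (Finsupp.single (l, v) 1) = letterOp c K x (wordVec c K l v) := by
  rw [letterOp_single, letterOp_wordVec]

theorem vertexOp_single_eq_wordVec (u : V) (l : List (IdxEdge E)) (v : V) :
    vertexOp c K u (Finsupp.single (l, v) 1) = vertexOp c K u (wordVec c K l v) := by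
  rw [vertexOp_wordVec]
  simp [vertexOp]

open Classical in
theorem vertexOp_mul (u w : V) :
    vertexOp c K u * vertexOp c K w = if u = w then vertexOp c K u else 0 := by
  refine end_ext fun l v => ?_
  rw [Module.End.mul_apply, vertexOp_single_eq_wordVec, vertexOp_wordVec]
  split_ifs with h1 h2 h2
  · rw [vertexOp_single_eq_wordVec]
  · rw [vertexOp_wordVec, if_neg fun h => h2 (h.symm.trans h1)]; rfl
  · subst h2
    rw [map_zero, vertexOp_single_eq_wordVec, vertexOp_wordVec, if_neg h1]
  · rw [map_zero]; rfl

theorem letterOp_mul_vertexOp (x : IdxEdge E) :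
    letterOp c K x * vertexOp c K (G.idxRng x) = letterOp c K x := by
  refine end_ext fun l v => ?_
  rw [Module.End.mul_apply, vertexOp_single_eq_wordVec, vertexOp_wordVec,
    letterOp_single_eq_wordVec]
  split_ifs with h
  · rfl
  · rw [map_zero, letterOp_wordVec, letterMul_eq_zero_of_ne (Ne.symm h)]

theorem vertexOp_wordVec_cons {x : IdxEdge E} {u : V} (h : G.idxSrc x = u)
    (l : List (IdxEdge E)) (v : V) :
    vertexOp c K u (wordVec c K (x :: l) v) = wordVec c K (x :: l) v := by
  rw [vertexOp_wordVec, if_pos (show G.wordSrc (x :: l) v = u from h)]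

theorem vertexOp_wordVec_of_eq {u : V} {l : List (IdxEdge E)} {v : V} (h : G.wordSrc l v = u) :
    vertexOp c K u (wordVec c K l v) = wordVec c K l v := by
  rw [vertexOp_wordVec, if_pos h]

theorem vertexOp_mul_letterOp (x : IdxEdge E) :
    vertexOp c K (G.idxSrc x) * letterOp c K x = letterOp c K x := by
  classical
  refine end_ext fun l v => ?_
  rw [Module.End.mul_apply, letterOp_single]
  match x, l with
  | real e i, ghost f j :: l =>
    rw [letterMul]
    split_ifs with h h2
    · obtain ⟨h, rfl, -, -⟩ := h
      rw [map_sub, map_sum,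
        vertexOp_wordVec_of_eq (show G.wordSrc l v = G.idxSrc (real e i) from h.2.1.symm)]
      congr 1
      exact Finset.sum_congr rfl fun g hg => vertexOp_wordVec_cons (x := real g i)
        (mem_emitted.1 (Finset.mem_of_mem_erase hg)) _ _
    · rw [map_sub, map_sum, map_zero]
      congr 1
      exact Finset.sum_congr rfl fun g hg => vertexOp_wordVec_cons (x := real g i)
        (mem_emitted.1 (Finset.mem_of_mem_erase hg)) _ _
    · exact vertexOp_wordVec_cons rfl _ _
  | ghost e i, real f j :: l =>
    rw [letterMul]
    split_ifs with h h2
    · obtain ⟨h, -, -, -⟩ := h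
      rw [map_sub, map_sum,
        vertexOp_wordVec_of_eq (show G.wordSrc l v = G.idxSrc (ghost e i) from h2 ▸ h.2.1.symm)]
      congr 1
      exact Finset.sum_congr rfl fun k _ => vertexOp_wordVec_cons rfl _ _
    · rw [map_sub, map_sum, map_zero]
      congr 1
      exact Finset.sum_congr rfl fun k _ => vertexOp_wordVec_cons rfl _ _
    · exact vertexOp_wordVec_cons rfl _ _
  | real e i, [] => exact vertexOp_wordVec_cons rfl _ _
  | ghost e i, [] => exact vertexOp_wordVec_cons rfl _ _
  | real e i, real f j :: l => exact vertexOp_wordVec_cons rfl _ _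
  | ghost e i, ghost f j :: l => exact vertexOp_wordVec_cons rfl _ _

open Classical in
-- The case without overlap: the ghost letter attaches without rewriting. Then only the summand of
-- the special edge is rewritten, and its correction terms cancel all other summands.
theorem sum_real_ghost_of_ne {v : V} (hv : G.IsRegular v) {i j : ℕ} (hi : i < G.vertexWeight v)
    (hj : j < G.vertexWeight v) {l : List (IdxEdge E)} {u : V}
    (hs : G.wordSrc l u = v) (hgood : ∀ f, j = 0 → real f 0 ∉ l.head?) :
    ∑ e ∈ G.emitted v, letterOp c K (real e i) (letterOp c K (ghost e j) (wordVec c K l u)) =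
      if i = j then wordVec c K l u else 0 := by
  by_cases hl : Reduced c l u
  swap
  · simp [wordVec_of_not_reduced hl]
  have h1 : ∀ e, letterOp c K (ghost e j) (wordVec c K l u) =
      wordVec c K (ghost e j :: l) u := by
    intro e
    rw [letterOp_wordVec, letterMul_of_not_clash]
    intro y hy hcl
    match y, hcl with
    | real f k, hcl =>
      obtain ⟨h0, rfl, -⟩ := hcl
      exact hgood f h0 hy
  simp only [h1, letterOp_wordVec]
  set s := c.edge v hv with hsdef
  have hsp : IsSpecial c s := isSpecial_edge c v hv
  have hsv : G.src s = v := c.src_edge v hv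
  have hsw : G.weight s = G.vertexWeight v := c.weight_edge v hv
  have hred : Reduced c (ghost s j :: l) u := by
    refine ⟨show j < G.weight s from hsw ▸ hj, hsv.trans hs.symm, ?_, hl⟩
    intro y hy hcl
    match y, hcl with
    | real f k, hcl =>
      obtain ⟨h0, rfl, -⟩ := hcl
      exact hgood f h0 hy
  rw [← Finset.add_sum_erase _ _ (mem_emitted.2 hsv),
    letterMul_real_ghost hred hsp (hsw ▸ hi), hsv, sub_add_eq_add_sub, sub_eq_iff_eq_add]
  congr 1
  refine Finset.sum_congr rfl fun g hg => letterMul_of_not_clash ?_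
  rintro y hy hcl
  obtain rfl : ghost g j = y := by simpa using hy
  exact (Finset.mem_erase.1 hg).1
    (hcl.2.eq hsp ((mem_emitted.1 (Finset.mem_erase.1 hg).2).trans hsv.symm))

open Classical in
-- In the remaining overlap `e_i e_0* f_0 l` the inner pair is rewritten first, which leads back to
-- the case without overlap with indices `k ≥ 1`. What is left is `f_i l - ∑_{k ≥ 1} δ_{ik} f_k l`,
-- that is, `f_0 l` for `i = 0` and zero otherwise.
theorem sum_real_ghost {v : V} (hv : G.IsRegular v) {i j : ℕ} (hi : i < G.vertexWeight v)
    (hj : j < G.vertexWeight v) :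
    ∑ e ∈ G.emitted v, letterOp c K (real e i) * letterOp c K (ghost e j) =
      if i = j then vertexOp c K v else 0 := by
  refine end_ext fun l u => ?_
  have e1 : (if i = j then vertexOp c K v else 0) (Finsupp.single (l, u) 1) =
      if i = j then (if G.wordSrc l u = v then wordVec c K l u else 0) else 0 := by
    split_ifs with _ h2
    · rw [vertexOp_single_eq_wordVec, vertexOp_wordVec, if_pos h2]
    · rw [vertexOp_single_eq_wordVec, vertexOp_wordVec, if_neg h2]
    · rfl
  rw [e1, LinearMap.sum_apply]
  simp only [Module.End.mul_apply, letterOp_single_eq_wordVec (ghost _ _)]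
  by_cases hs : G.wordSrc l u = v
  swap
  · rw [if_neg hs, ite_self]
    refine Finset.sum_eq_zero fun e he => ?_
    rw [letterOp_wordVec, letterMul_eq_zero_of_ne, map_zero]
    exact fun h => hs (h.symm.trans (mem_emitted.1 he))
  rw [if_pos hs]
  by_cases hgood : ∀ f, j = 0 → real f 0 ∉ l.head?
  · exact sum_real_ghost_of_ne hv hi hj hs hgood
  push Not at hgood
  obtain ⟨f, rfl, hf⟩ := hgood
  obtain ⟨l, rfl⟩ := List.head?_eq_some_iff.1 hf
  by_cases hred : Reduced c (real f 0 :: l) u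
  swap
  · simp [wordVec_of_not_reduced hred]
  have hfv : G.src f = v := hs
  have h1 : ∀ e ∈ G.emitted v, letterOp c K (real e i)
      (letterOp c K (ghost e 0) (wordVec c K (real f 0 :: l) u)) =
      (if e = f then letterOp c K (real f i) (wordVec c K l u) else 0) -
        ∑ k ∈ Finset.Ico 1 (G.vertexWeight v), letterOp c K (real e i)
          (letterOp c K (ghost e k) (wordVec c K (real f k :: l) u)) := by
    intro e he
    have hev := mem_emitted.1 he
    rw [letterOp_wordVec (ghost e 0), letterMul_ghost_real hred (hev.trans hfv.symm), map_sub,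
      map_sum, hev]
    congr 1
    · split_ifs with h
      · rw [h]
      · rw [map_zero]
    · refine Finset.sum_congr rfl fun k hk => ?_
      rw [letterOp_wordVec (ghost e k), letterMul_of_not_clash]
      intro y hy hcl
      obtain rfl : real f k = y := by simpa using hy
      have := (Finset.mem_Ico.1 hk).1
      have := hcl.1
      omega
  rw [Finset.sum_congr rfl h1, Finset.sum_sub_distrib, Finset.sum_ite_eq',
    if_pos (mem_emitted.2 hfv), Finset.sum_comm]
  have h2 : ∀ k ∈ Finset.Ico 1 (G.vertexWeight v), ∑ e ∈ G.emitted v, letterOp c K (real e i)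
      (letterOp c K (ghost e k) (wordVec c K (real f k :: l) u)) =
      if i = k then wordVec c K (real f k :: l) u else 0 := by
    intro k hk
    rw [Finset.mem_Ico] at hk
    exact sum_real_ghost_of_ne hv hi hk.2 hs fun _ h0 => by omega
  rw [Finset.sum_congr rfl h2, Finset.sum_ite_eq, letterOp_wordVec, letterMul_of_not_clash]
  · by_cases hi0 : i = 0
    · subst hi0
      simp
    · rw [if_pos (Finset.mem_Ico.2 ⟨by omega, hi⟩), if_neg hi0, sub_self]
  · intro y hy hcl
    refine hred.2.2.1 y hy ?_
    cases y <;> exact hcl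

open Classical in
-- The mirror image of `sum_real_ghost_of_ne`: only the summand of index 0 is rewritten, and its
-- correction terms cancel the summands of positive index.
theorem sum_ghost_real_of_ne {e f : E} (hef : G.src e = G.src f) {l : List (IdxEdge E)} {u : V}
    (hs : G.rng f = G.wordSrc l u) (hgood : ∀ j, IsSpecial c f → ghost f j ∉ l.head?) :
    ∑ i ∈ Finset.range (G.vertexWeight (G.src e)),
      letterOp c K (ghost e i) (letterOp c K (real f i) (wordVec c K l u)) =
      if e = f then wordVec c K l u else 0 := by
  by_cases hl : Reduced c l u
  swap
  · simp [wordVec_of_not_reduced hl]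
  have hcl0 : ∀ i, ∀ y ∈ l.head?, ¬ Clash c (real f i) y := by
    intro i y hy hcl
    match y, hcl with
    | ghost g k, hcl =>
      obtain ⟨rfl, h0⟩ := hcl
      exact hgood k h0 hy
  have h1 : ∀ i, letterOp c K (real f i) (wordVec c K l u) =
      wordVec c K (real f i :: l) u := by
    intro i
    rw [letterOp_wordVec, letterMul_of_not_clash (hcl0 i)]
  simp only [h1, letterOp_wordVec]
  have hred : Reduced c (real f 0 :: l) u := ⟨G.weight_pos f, hs, hcl0 0, hl⟩
  have hpos : 0 < G.vertexWeight (G.src e) := (G.weight_pos e).trans_le (weight_le_vertexWeight e)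
  rw [Finset.range_eq_Ico, Finset.sum_eq_sum_Ico_succ_bot hpos, letterMul_ghost_real hred hef,
    sub_add_eq_add_sub, sub_eq_iff_eq_add]
  congr 1
  refine Finset.sum_congr rfl fun k hk => letterMul_of_not_clash ?_
  rintro y hy hcl
  obtain rfl : real f k = y := by simpa using hy
  have := (Finset.mem_Ico.1 hk).1
  have := hcl.1
  omega

open Classical in
-- In the overlap `e_i* f_i f_j* l` with `f` special the pair `f_i f_j*` is rewritten first. The
-- correction terms involve only edges `g ≠ f`, which are not special, so the case without overlap
-- applies to them.
theorem sum_ghost_real {e f : E} (hef : G.src e = G.src f) :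
    ∑ i ∈ Finset.range (G.vertexWeight (G.src e)),
      letterOp c K (ghost e i) * letterOp c K (real f i) =
      if e = f then vertexOp c K (G.rng e) else 0 := by
  refine end_ext fun l u => ?_
  have e1 : (if e = f then vertexOp c K (G.rng e) else 0) (Finsupp.single (l, u) 1) =
      if e = f then (if G.wordSrc l u = G.rng f then wordVec c K l u else 0) else 0 := by
    split_ifs with h1 h2
    · rw [vertexOp_single_eq_wordVec, vertexOp_wordVec, if_pos (h1 ▸ h2)]
    · rw [vertexOp_single_eq_wordVec, vertexOp_wordVec, if_neg (h1 ▸ h2)]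
    · rfl
  rw [e1, LinearMap.sum_apply]
  simp only [Module.End.mul_apply, letterOp_single_eq_wordVec (real _ _)]
  by_cases hs : G.wordSrc l u = G.rng f
  swap
  · rw [if_neg hs, ite_self]
    refine Finset.sum_eq_zero fun i _ => ?_
    rw [letterOp_wordVec, letterMul_eq_zero_of_ne (Ne.symm hs), map_zero]
  rw [if_pos hs]
  by_cases hgood : ∀ j, IsSpecial c f → ghost f j ∉ l.head?
  · exact sum_ghost_real_of_ne hef hs.symm hgood
  push Not at hgood
  obtain ⟨j, hsp, hf⟩ := hgood
  obtain ⟨l, rfl⟩ := List.head?_eq_some_iff.1 hf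
  by_cases hred : Reduced c (ghost f j :: l) u
  swap
  · simp [wordVec_of_not_reduced hred]
  have hj : j < G.weight f := hred.1
  have hjv : j < G.vertexWeight (G.src e) := hef ▸ hsp.weight_eq ▸ hj
  have h1 : ∀ i ∈ Finset.range (G.vertexWeight (G.src e)), letterOp c K (ghost e i)
      (letterOp c K (real f i) (wordVec c K (ghost f j :: l) u)) =
      (if i = j then letterOp c K (ghost e j) (wordVec c K l u) else 0) -
        ∑ g ∈ (G.emitted (G.src f)).erase f, letterOp c K (ghost e i)
          (letterOp c K (real g i) (wordVec c K (ghost g j :: l) u)) := by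
    intro i hi
    rw [letterOp_wordVec (real f i), letterMul_real_ghost hred hsp
      (by rw [hsp.weight_eq, ← hef]; exact Finset.mem_range.1 hi), map_sub, map_sum]
    congr 1
    · split_ifs with h
      · rw [h]
      · rw [map_zero]
    · refine Finset.sum_congr rfl fun g hg => ?_
      rw [letterOp_wordVec (real g i), letterMul_of_not_clash]
      intro y hy hcl
      obtain rfl : ghost g j = y := by simpa using hy
      exact (Finset.mem_erase.1 hg).1 (hcl.2.eq hsp (mem_emitted.1 (Finset.mem_erase.1 hg).2))
  rw [Finset.sum_congr rfl h1, Finset.sum_sub_distrib, Finset.sum_ite_eq',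
    if_pos (Finset.mem_range.2 hjv), Finset.sum_comm]
  have h2 : ∀ g ∈ (G.emitted (G.src f)).erase f,
      ∑ i ∈ Finset.range (G.vertexWeight (G.src e)), letterOp c K (ghost e i)
      (letterOp c K (real g i) (wordVec c K (ghost g j :: l) u)) =
      if e = g then wordVec c K (ghost g j :: l) u else 0 := by
    intro g hg
    rw [Finset.mem_erase, mem_emitted] at hg
    exact sum_ghost_real_of_ne (hef.trans hg.2.symm) rfl fun k hk => absurd (hk.eq hsp hg.2) hg.1
  rw [Finset.sum_congr rfl h2, Finset.sum_ite_eq, letterOp_wordVec, letterMul_of_not_clash]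
  · by_cases hi0 : e = f
    · subst hi0
      simp
    · rw [if_pos (Finset.mem_erase.2 ⟨hi0, mem_emitted.2 hef⟩), if_neg hi0, sub_self]
  · intro y hy hcl
    refine hred.2.2.1 y hy ?_
    match y, hcl with
    | real g k, hcl => exact ⟨hcl.1, hcl.2.1, hef.symm.trans hcl.2.2⟩

end Rep

end WeightedGraph

/-! ### Linear independence of the nod-paths in the algebra -/

namespace WeightedGraph

open IdxEdge

variable {V E : Type*}

/-- An edge of the double graph as an indexed letter. -/
def toIdx {G : WeightedGraph V E} : G.DEdge → IdxEdge E
  | Sum.inl x => real x.1 x.2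
  | Sum.inr x => ghost x.1 x.2

theorem toIdx_injective {G : WeightedGraph V E} : Function.Injective (toIdx (G := G)) := by
  rintro (⟨e, i⟩ | ⟨e, i⟩) (⟨f, j⟩ | ⟨f, j⟩) h
  · obtain rfl : e = f := (IdxEdge.real.inj h).1
    obtain rfl : i = j := Fin.ext (IdxEdge.real.inj h).2
    rfl
  · cases h
  · cases h
  · obtain rfl : e = f := (IdxEdge.ghost.inj h).1
    obtain rfl : i = j := Fin.ext (IdxEdge.ghost.inj h).2
    rfl

theorem inRange_toIdx {G : WeightedGraph V E} (x : G.DEdge) : G.InRange (toIdx x) := by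
  rcases x with ⟨e, i⟩ | ⟨e, i⟩ <;> exact i.2

theorem exists_toIdx_eq {G : WeightedGraph V E} {x : IdxEdge E} (h : G.InRange x) :
    ∃ y : G.DEdge, toIdx y = x := by
  cases x with
  | real e i => exact ⟨Sum.inl ⟨e, i, h⟩, rfl⟩
  | ghost e i => exact ⟨Sum.inr ⟨e, i, h⟩, rfl⟩

variable [Fintype E] {G : WeightedGraph V E}

section Basis

variable (c : G.SpecialEdges) (K : Type*) [Field K]

/-- The operator of a generator. -/
noncomputable def genOp : G.Letter → Module.End K (WordSpace K V E)
  | Sum.inl v => vertexOp c K v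
  | Sum.inr x => letterOp c K (toIdx x)

/-- The representation of the free algebra on the space of words. -/
noncomputable def rep : FreeNUAlgebra K G.Letter →ₙₐ[K] Module.End K (WordSpace K V E) :=
  MonoidAlgebra.liftMagma K (FreeSemigroup.lift (genOp c K))

theorem rep_gen (x : G.Letter) : rep c K (FreeNUAlgebra.gen K x) = genOp c K x := by
  simp [rep, FreeNUAlgebra.gen]

theorem rep_gen_vertex (v : V) :
    rep c K (FreeNUAlgebra.gen K (Sum.inl v)) = vertexOp c K v := rep_gen c K _

theorem rep_gen_edge (x : G.DEdge) :
    rep c K (FreeNUAlgebra.gen K (Sum.inr x)) = letterOp c K (toIdx x) := rep_gen c K _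

theorem rep_realElt (e : E) (i : ℕ) : rep c K (G.realElt K e i) = letterOp c K (real e i) := by
  unfold realElt
  split_ifs with h
  · rw [rep_gen]; rfl
  · rw [map_zero, letterOp_eq_zero (x := real e i) h]

theorem rep_ghostElt (e : E) (i : ℕ) : rep c K (G.ghostElt K e i) = letterOp c K (ghost e i) := by
  unfold ghostElt
  split_ifs with h
  · rw [rep_gen]; rfl
  · rw [map_zero, letterOp_eq_zero (x := ghost e i) h]

theorem rep_eq_of_leavittRel {a b : FreeNUAlgebra K G.Letter} (h : G.LeavittRel K a b) :
    rep c K a = rep c K b := by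
  classical
  cases h with
  | path h =>
    cases h with
    | vertex u v =>
      rw [map_mul, rep_gen_vertex, rep_gen_vertex, apply_ite (rep c K), rep_gen_vertex, map_zero]
      convert vertexOp_mul (c := c) (K := K) u v
    | src e =>
      rw [map_mul, rep_gen_vertex, rep_gen_edge]
      convert vertexOp_mul_letterOp (c := c) (K := K) (toIdx e) using 2
      rcases e with e | e <;> rfl
    | rng e =>
      rw [map_mul, rep_gen_vertex, rep_gen_edge]
      convert letterOp_mul_vertexOp (c := c) (K := K) (toIdx e) using 2
      rcases e with e | e <;> rfl
  | real_ghost v hv i j hi hj =>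
    simp only [map_sum, map_mul, rep_realElt, rep_ghostElt, apply_ite (rep c K),
      rep_gen_vertex, map_zero]
    convert sum_real_ghost hv hi hj
  | ghost_real v hv e f he hf =>
    subst he
    simp only [map_sum, map_mul, rep_realElt, rep_ghostElt, apply_ite (rep c K),
      rep_gen_vertex, map_zero]
    convert sum_ghost_real hf.symm

variable (G) in
/-- The element of the free algebra given by an indexed letter. -/
noncomputable def idxFree : IdxEdge E → FreeNUAlgebra K G.Letter
  | real e i => G.realElt K e i
  | ghost e i => G.ghostElt K e i

variable (G) in
/-- The element of the free algebra given by a word. -/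
noncomputable def wordFree : List (IdxEdge E) → V → FreeNUAlgebra K G.Letter
  | [], v => FreeNUAlgebra.gen K (Sum.inl v)
  | x :: l, v => idxFree G K x * wordFree l v

variable (G) in
/-- The element of the weighted Leavitt path algebra given by an indexed letter. -/
noncomputable def idxElt (x : IdxEdge E) : G.LeavittPathAlgebra K := AlgQuot.mk K _ (idxFree G K x)

variable (G) in
/-- The element of the weighted Leavitt path algebra given by a vertex. -/
noncomputable def vtxElt (v : V) : G.LeavittPathAlgebra K :=
  AlgQuot.mk K _ (FreeNUAlgebra.gen K (Sum.inl v))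

variable (G) in
/-- The element of the weighted Leavitt path algebra given by a word. -/
noncomputable def wordElt (l : List (IdxEdge E)) (v : V) : G.LeavittPathAlgebra K :=
  AlgQuot.mk K _ (wordFree G K l v)

/-- The sum of the empty words at all vertices serves as a cyclic vector: the end vertex selects one
summand, and the letters of a reduced word then attach without any rewriting. -/
theorem rep_wordFree [Fintype V] {l : List (IdxEdge E)} {v : V} (h : Reduced c l v) :
    rep c K (wordFree G K l v) (∑ u, wordVec c K [] u) = Finsupp.single (l, v) 1 := by
  classical
  rw [← wordVec_of_reduced h]
  induction l with
  | nil =>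
    rw [wordFree, rep_gen_vertex, map_sum, Finset.sum_eq_single v]
    · exact vertexOp_wordVec_of_eq rfl
    · intro u _ hu
      rw [vertexOp_wordVec, if_neg (show G.wordSrc [] u ≠ v from hu)]
    · simp
  | cons x l ih =>
    have hx : rep c K (idxFree G K x) = letterOp c K x := by
      cases x
      exacts [rep_realElt c K _ _, rep_ghostElt c K _ _]
    rw [wordFree, map_mul, Module.End.mul_apply, ih h.2.2.2, hx, letterOp_wordVec,
      letterMul_of_not_clash h.2.2.1]

/-- Acting on the cyclic vector is a linear map that sends the given elements to distinct basis
vectors. -/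
theorem linearIndependent_wordElt [Finite V] (S : Set (List (IdxEdge E) × V))
    (hS : ∀ p ∈ S, Reduced c p.1 p.2) :
    LinearIndependent K fun p : S => wordElt G K p.1.1 p.1.2 := by
  have := Fintype.ofFinite V
  let ψ : G.LeavittPathAlgebra K →ₗ[K] Module.End K (WordSpace K V E) :=
    AlgQuot.liftLinear (K := K) (A := FreeNUAlgebra K G.Letter)
      (B := Module.End K (WordSpace K V E)) (r := G.LeavittRel K) (rep c K)
      fun _ _ h => rep_eq_of_leavittRel c K h
  let φ : G.LeavittPathAlgebra K →ₗ[K] WordSpace K V E :=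
    LinearMap.applyₗ (∑ u, wordVec c K [] u) ∘ₗ ψ
  refine LinearIndependent.of_comp φ ?_
  have hφ : (φ ∘ fun p : S => wordElt G K p.1.1 p.1.2) =
      (fun p => Finsupp.single p (1 : K)) ∘ ((↑) : S → List (IdxEdge E) × V) := by
    funext p
    exact rep_wordFree c K (hS p.1 p.2)
  rw [hφ]
  exact (Finsupp.linearIndependent_single_one K _).comp _ Subtype.val_injective

/-! ### Relations between the generators -/

variable {K}

theorem idxElt_eq_zero {x : IdxEdge E} (h : ¬ G.InRange x) : idxElt G K x = 0 := by
  cases x with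
  | real e i => exact (congrArg (AlgQuot.mk K _) (dif_neg h)).trans AlgQuot.mk_zero
  | ghost e i => exact (congrArg (AlgQuot.mk K _) (dif_neg h)).trans AlgQuot.mk_zero

theorem idxElt_toIdx (x : G.DEdge) :
    idxElt G K (toIdx x) = AlgQuot.mk K _ (FreeNUAlgebra.gen K (Sum.inr x)) := by
  rcases x with ⟨e, i⟩ | ⟨e, i⟩ <;> exact congrArg (AlgQuot.mk K _) (dif_pos i.2)

theorem wordElt_cons (x : IdxEdge E) (l : List (IdxEdge E)) (v : V) :
    wordElt G K (x :: l) v = idxElt G K x * wordElt G K l v := rfl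

open Classical in
theorem vtxElt_mul (u v : V) :
    vtxElt G K u * vtxElt G K v = if u = v then vtxElt G K u else 0 := by
  refine (AlgQuot.mk_eq_of_rel (.path (.vertex u v))).trans ?_
  split_ifs <;> rfl

theorem vtxElt_mul_idxElt (x : IdxEdge E) :
    vtxElt G K (G.idxSrc x) * idxElt G K x = idxElt G K x := by
  by_cases h : G.InRange x
  · obtain ⟨y, rfl⟩ := exists_toIdx_eq h
    rw [idxElt_toIdx]
    have hy : G.idxSrc (toIdx y) = G.hat.double.src y := by rcases y with y | y <;> rfl
    rw [hy]
    exact AlgQuot.mk_eq_of_rel (.path (.src y))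
  · rw [idxElt_eq_zero h, mul_zero]

theorem idxElt_mul_vtxElt (x : IdxEdge E) :
    idxElt G K x * vtxElt G K (G.idxRng x) = idxElt G K x := by
  by_cases h : G.InRange x
  · obtain ⟨y, rfl⟩ := exists_toIdx_eq h
    rw [idxElt_toIdx]
    have hy : G.idxRng (toIdx y) = G.hat.double.rng y := by rcases y with y | y <;> rfl
    rw [hy]
    exact AlgQuot.mk_eq_of_rel (.path (.rng y))
  · rw [idxElt_eq_zero h, zero_mul]

open Classical in
theorem sum_idxElt_real_ghost {v : V} (hv : G.IsRegular v) {i j : ℕ}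
    (hi : i < G.vertexWeight v) (hj : j < G.vertexWeight v) :
    ∑ e ∈ G.emitted v, idxElt G K (real e i) * idxElt G K (ghost e j) =
      if i = j then vtxElt G K v else 0 := by
  have h := AlgQuot.mk_eq_of_rel (K := K) (LeavittRel.real_ghost (K := K) v hv i j hi hj)
  rw [AlgQuot.mk_sum] at h
  refine h.trans ?_
  split_ifs <;> rfl

open Classical in
theorem sum_idxElt_ghost_real {e f : E} (hef : G.src e = G.src f) :
    ∑ i ∈ Finset.range (G.vertexWeight (G.src e)), idxElt G K (ghost e i) * idxElt G K (real f i) =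
      if e = f then vtxElt G K (G.rng e) else 0 := by
  have h := AlgQuot.mk_eq_of_rel (K := K)
    (LeavittRel.ghost_real (K := K) (G.src e) ⟨e, rfl⟩ e f rfl hef.symm)
  rw [AlgQuot.mk_sum] at h
  refine h.trans ?_
  split_ifs <;> rfl

open Classical in
theorem vtxElt_mul_wordElt (u : V) (l : List (IdxEdge E)) (v : V) :
    vtxElt G K u * wordElt G K l v = if G.wordSrc l v = u then wordElt G K l v else 0 := by
  have key : vtxElt G K (G.wordSrc l v) * wordElt G K l v = wordElt G K l v := by
    cases l with
    | nil => exact (vtxElt_mul v v).trans (if_pos rfl)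
    | cons x l => rw [wordElt_cons, ← mul_assoc]; exact congrArg (· * _) (vtxElt_mul_idxElt x)
  split_ifs with h
  · rw [← h, key]
  · rw [← key, ← mul_assoc, vtxElt_mul, if_neg (Ne.symm h), zero_mul]

theorem idxElt_mul_wordElt_of_ne {x : IdxEdge E} {l : List (IdxEdge E)} {v : V}
    (h : G.idxRng x ≠ G.wordSrc l v) : idxElt G K x * wordElt G K l v = 0 := by
  rw [← idxElt_mul_vtxElt, mul_assoc, vtxElt_mul_wordElt, if_neg h.symm, mul_zero]

/-! ### The filtration by length -/

variable (K)

/-- The reduced words of length at most `n`. -/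
def reducedWords (n : ℕ) : Set (List (IdxEdge E) × V) :=
  {p | Reduced c p.1 p.2 ∧ p.1.length ≤ n}

/-- The span of the reduced words of length at most `n`. -/
noncomputable def wordSpan (n : ℕ) : Submodule K (G.LeavittPathAlgebra K) :=
  Submodule.span K (Set.range fun p : reducedWords c n => wordElt G K p.1.1 p.1.2)

variable {K}

theorem wordElt_mem_wordSpan {l : List (IdxEdge E)} {v : V} {n : ℕ} (h : Reduced c l v)
    (hn : l.length ≤ n) : wordElt G K l v ∈ wordSpan c K n :=
  Submodule.subset_span ⟨⟨(l, v), h, hn⟩, rfl⟩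

theorem wordSpan_mono : Monotone (wordSpan c K) := by
  intro m n hmn
  refine Submodule.span_le.2 ?_
  rintro _ ⟨⟨⟨l, v⟩, h, hl⟩, rfl⟩
  exact wordElt_mem_wordSpan c h (hl.trans hmn)

theorem cons_mem_wordSpan {x : IdxEdge E} {l : List (IdxEdge E)} {v : V} {n : ℕ}
    (h : G.InRange x → Reduced c (x :: l) v) (hn : l.length + 1 ≤ n) :
    wordElt G K (x :: l) v ∈ wordSpan c K n := by
  by_cases hx : G.InRange x
  · exact wordElt_mem_wordSpan c (h hx) hn
  · rw [wordElt_cons, idxElt_eq_zero hx, zero_mul]; exact zero_mem _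

theorem vtxElt_mul_mem_wordSpan (u : V) {n : ℕ} {a : G.LeavittPathAlgebra K}
    (ha : a ∈ wordSpan c K n) : vtxElt G K u * a ∈ wordSpan c K n := by
  induction ha using Submodule.span_induction with
  | zero => simp
  | add x y _ _ hx hy => rw [mul_add]; exact add_mem hx hy
  | smul k x _ hx => rw [mul_smul_comm]; exact Submodule.smul_mem _ _ hx
  | mem x hx =>
    obtain ⟨⟨⟨l, v⟩, h, hl⟩, rfl⟩ := hx
    dsimp only
    rw [vtxElt_mul_wordElt]
    split_ifs
    exacts [wordElt_mem_wordSpan c h hl, zero_mem _]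

/-- A forbidden pair at the front is replaced by the other terms of its relation. These contain a
non-special edge or a positive index in its place, so they are already reduced, or zero if an index
is out of range. No second rewriting occurs, and the length grows by at most one. -/
theorem idxElt_mul_wordElt_mem (x : IdxEdge E) {l : List (IdxEdge E)} {v : V} {n : ℕ}
    (hl : Reduced c l v) (hn : l.length ≤ n) :
    idxElt G K x * wordElt G K l v ∈ wordSpan c K (n + 1) := by
  classical
  by_cases hx : G.InRange x
  swap
  · rw [idxElt_eq_zero hx, zero_mul]; exact zero_mem _
  by_cases hs : G.idxRng x = G.wordSrc l v
  swap
  · rw [idxElt_mul_wordElt_of_ne hs]; exact zero_mem _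
  by_cases hcl : ∀ y ∈ l.head?, ¬ Clash c x y
  · exact wordElt_mem_wordSpan c (l := x :: l) ⟨hx, hs, hcl, hl⟩ (by simpa using hn)
  push Not at hcl
  obtain ⟨y, hy, hcl⟩ := hcl
  obtain ⟨l, rfl⟩ := List.head?_eq_some_iff.1 hy
  have hn' : l.length + 1 ≤ n := hn
  match x, y, hcl with
  | real e i, ghost f j, hcl =>
    obtain ⟨rfl, hsp⟩ := hcl
    have hi : i < G.vertexWeight (G.src e) := hsp.weight_eq ▸ hx
    have hj : j < G.vertexWeight (G.src e) := hsp.weight_eq ▸ hl.1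
    have hrel := sum_idxElt_real_ghost (K := K) ⟨e, rfl⟩ hi hj
    rw [← Finset.add_sum_erase _ _ (mem_emitted.2 rfl), ← eq_sub_iff_add_eq] at hrel
    rw [wordElt_cons, ← mul_assoc, hrel, sub_mul, Finset.sum_mul]
    refine sub_mem ?_ (sum_mem fun g hg => ?_)
    · split_ifs
      · exact vtxElt_mul_mem_wordSpan c _ (wordElt_mem_wordSpan c hl.2.2.2 (by omega))
      · rw [zero_mul]; exact zero_mem _
    · rw [Finset.mem_erase, mem_emitted] at hg
      rw [mul_assoc, ← wordElt_cons, ← wordElt_cons]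
      by_cases hgj : j < G.weight g
      · refine cons_mem_wordSpan c (fun hgi => ⟨hgi, rfl, ?_, hl.ghost_congr hg.2 hgj⟩)
          (by simpa using hn')
        rintro y hy hcl
        obtain rfl : ghost g j = y := by simpa using hy
        exact hg.1 (hcl.2.eq hsp hg.2)
      · rw [wordElt_cons, wordElt_cons, idxElt_eq_zero (x := ghost g j) hgj, zero_mul, mul_zero]
        exact zero_mem _
  | ghost e i, real f j, hcl =>
    obtain ⟨rfl, rfl, hef⟩ := hcl
    have hpos : 0 < G.vertexWeight (G.src e) :=
      (G.weight_pos e).trans_le (weight_le_vertexWeight e)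
    have hrel := sum_idxElt_ghost_real (K := K) hef
    rw [Finset.range_eq_Ico, Finset.sum_eq_sum_Ico_succ_bot hpos, ← eq_sub_iff_add_eq] at hrel
    rw [wordElt_cons, ← mul_assoc, hrel, sub_mul, Finset.sum_mul]
    refine sub_mem ?_ (sum_mem fun k hk => ?_)
    · split_ifs
      · exact vtxElt_mul_mem_wordSpan c _ (wordElt_mem_wordSpan c hl.2.2.2 (by omega))
      · rw [zero_mul]; exact zero_mem _
    · rw [Finset.mem_Ico] at hk
      rw [mul_assoc, ← wordElt_cons, ← wordElt_cons]
      by_cases hfk : k < G.weight f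
      · refine cons_mem_wordSpan c (fun hek => ⟨hek, hef, ?_, hl.real_congr hfk⟩)
          (by simpa using hn')
        rintro y hy hcl
        obtain rfl : real f k = y := by simpa using hy
        have := hcl.1
        omega
      · rw [wordElt_cons, wordElt_cons, idxElt_eq_zero (x := real f k) hfk, zero_mul, mul_zero]
        exact zero_mem _

theorem idxElt_mul_mem_wordSpan (x : IdxEdge E) {n : ℕ} {a : G.LeavittPathAlgebra K}
    (ha : a ∈ wordSpan c K n) : idxElt G K x * a ∈ wordSpan c K (n + 1) := by
  induction ha using Submodule.span_induction with
  | zero => simp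
  | add x y _ _ hx hy => rw [mul_add]; exact add_mem hx hy
  | smul k x _ hx => rw [mul_smul_comm]; exact Submodule.smul_mem _ _ hx
  | mem y hy =>
    obtain ⟨⟨⟨l, v⟩, h, hl⟩, rfl⟩ := hy
    exact idxElt_mul_wordElt_mem c x h hl

theorem wordElt_mul_mem_wordSpan (l : List (IdxEdge E)) (v : V) {n : ℕ}
    {a : G.LeavittPathAlgebra K} (ha : a ∈ wordSpan c K n) :
    wordElt G K l v * a ∈ wordSpan c K (l.length + n) := by
  induction l with
  | nil => rw [List.length_nil, Nat.zero_add]; exact vtxElt_mul_mem_wordSpan c v ha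
  | cons x l ih =>
    rw [wordElt_cons, mul_assoc, List.length_cons, Nat.add_right_comm]
    exact idxElt_mul_mem_wordSpan c x ih

theorem mul_mem_wordSpan {m n : ℕ} {a b : G.LeavittPathAlgebra K} (ha : a ∈ wordSpan c K m)
    (hb : b ∈ wordSpan c K n) : a * b ∈ wordSpan c K (m + n) := by
  induction ha using Submodule.span_induction with
  | zero => simp
  | add x y _ _ hx hy => rw [add_mul]; exact add_mem hx hy
  | smul k x _ hx => rw [smul_mul_assoc]; exact Submodule.smul_mem _ _ hx
  | mem y hy =>
    obtain ⟨⟨⟨l, v⟩, h, hl⟩, rfl⟩ := hy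
    exact wordSpan_mono c (Nat.add_le_add_right hl n) (wordElt_mul_mem_wordSpan c l v hb)

theorem idxElt_mem_wordSpan (x : IdxEdge E) : idxElt G K x ∈ wordSpan c K 1 := by
  rw [← idxElt_mul_vtxElt]
  exact idxElt_mul_mem_wordSpan c x (wordElt_mem_wordSpan c (l := []) trivial le_rfl)

theorem exists_mem_wordSpan (a : G.LeavittPathAlgebra K) : ∃ n, a ∈ wordSpan c K n := by
  obtain ⟨f, rfl⟩ := AlgQuot.mk_surjective K _ a
  have hword : ∀ w : FreeSemigroup G.Letter, ∃ n,
      AlgQuot.mk K (G.LeavittRel K) (MonoidAlgebra.single w 1) ∈ wordSpan c K n := by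
    intro w
    have hgen : ∀ x : G.Letter,
        AlgQuot.mk K (G.LeavittRel K) (FreeNUAlgebra.gen K x) ∈ wordSpan c K 1 := by
      rintro (v | x)
      · exact wordElt_mem_wordSpan c (l := []) trivial (by simp)
      · rw [← idxElt_toIdx]
        exact idxElt_mem_wordSpan c _
    induction w using FreeSemigroup.recOnMul with
    | ih1 x => exact ⟨1, hgen x⟩
    | ih2 x y hx hy =>
      obtain ⟨m, hm⟩ := hx
      obtain ⟨n, hn⟩ := hy
      refine ⟨m + n, ?_⟩
      have := mul_mem_wordSpan c hm hn
      rwa [← AlgQuot.mk_mul, MonoidAlgebra.single_mul_single, one_mul] at this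
  induction f using MonoidAlgebra.induction_linear with
  | zero => exact ⟨0, zero_mem _⟩
  | add f g hf hg =>
    obtain ⟨m, hm⟩ := hf
    obtain ⟨n, hn⟩ := hg
    exact ⟨max m n, add_mem (wordSpan_mono c (le_max_left m n) hm)
      (wordSpan_mono c (le_max_right m n) hn)⟩
  | single w k =>
    obtain ⟨n, hn⟩ := hword w
    refine ⟨n, ?_⟩
    have := Submodule.smul_mem _ k hn
    rwa [← AlgQuot.mk_smul, MonoidAlgebra.smul_single, smul_eq_mul, mul_one] at this

/-! ### Growth functions and the number of reduced words -/

theorem growthSpace_wordSpan {n : ℕ} (hn : 1 ≤ n) :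
    growthSpace (wordSpan c K 1) n = wordSpan c K n := by
  refine le_antisymm (growthSpace_le _ (wordSpan_mono c) le_rfl
    (fun n a ha b hb => mul_mem_wordSpan c ha hb) n) (Submodule.span_le.2 ?_)
  rintro _ ⟨⟨⟨l, v⟩, h, hl⟩, rfl⟩
  dsimp only at h hl ⊢
  induction l generalizing n with
  | nil => exact le_growthSpace _ hn (wordElt_mem_wordSpan c h (by simp))
  | cons x l ih =>
    -- A one-letter word lies in degree 1 as it stands; splitting it would spend an extra factor on
    -- its end vertex.
    rcases Nat.eq_zero_or_pos l.length with h0 | h0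
    · exact le_growthSpace _ hn (wordElt_mem_wordSpan c h (by simp [h0]))
    · obtain ⟨m, rfl⟩ : ∃ m, n = 1 + m := ⟨n - 1, by omega⟩
      rw [List.length_cons] at hl
      rw [wordElt_cons]
      exact mul_mem_growthSpace _ (le_growthSpace _ le_rfl (idxElt_mem_wordSpan c x))
        (ih (by omega) h.2.2.2 (by omega))

theorem exists_map_toIdx_eq {l : List (IdxEdge E)} {v : V} (h : Reduced c l v) :
    ∃ l' : List G.DEdge, l'.map toIdx = l := by
  induction l with
  | nil => exact ⟨[], rfl⟩
  | cons x l ih =>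
    obtain ⟨l', rfl⟩ := ih h.2.2.2
    obtain ⟨y, rfl⟩ := exists_toIdx_eq h.1
    exact ⟨y :: l', rfl⟩

theorem reducedWords_finite [Finite V] (n : ℕ) : (reducedWords c n).Finite := by
  refine (((List.finite_length_le G.DEdge n).prod (Set.finite_univ (α := V))).image
    fun p => (p.1.map toIdx, p.2)).subset ?_
  rintro ⟨l, v⟩ ⟨h, hl⟩
  obtain ⟨l', rfl⟩ := exists_map_toIdx_eq c h
  exact ⟨(l', v), ⟨by simpa using hl, trivial⟩, rfl⟩

theorem finiteDimensional_wordSpan [Finite V] (n : ℕ) :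
    FiniteDimensional K (wordSpan c K n) := by
  have := (reducedWords_finite c n).to_subtype
  exact FiniteDimensional.span_of_finite K (Set.finite_range _)

theorem finrank_wordSpan [Finite V] (n : ℕ) :
    Module.finrank K (wordSpan c K n) = (reducedWords c n).ncard := by
  have := (reducedWords_finite c n).fintype
  rw [wordSpan, finrank_span_eq_card (linearIndependent_wordElt c K _ fun p hp => hp.1),
    ← Nat.card_eq_fintype_card, Nat.card_coe_set_eq]

theorem isGeneratingSpace_wordSpan [Finite V] : IsGeneratingSpace (wordSpan c K 1) := by
  refine ⟨finiteDimensional_wordSpan c 1, fun a => ?_⟩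
  obtain ⟨n, hn⟩ := exists_mem_wordSpan c a
  refine ⟨n + 1, ?_⟩
  rw [growthSpace_wordSpan c (by omega)]
  exact wordSpan_mono c (Nat.le_succ n) hn

theorem finiteDimensional_growthSpace (c : G.SpecialEdges) [Finite V]
    {W : Submodule K (G.LeavittPathAlgebra K)}
    (hW : IsGeneratingSpace W) (n : ℕ) : FiniteDimensional K (growthSpace W n) := by
  have := hW.1
  obtain ⟨a, ha, h⟩ := (isGeneratingSpace_wordSpan (K := K) c).exists_le_growthSpace W
  -- Passing to `n + 1` covers `n = 0`, because `growthSpace_wordSpan` needs a positive exponent.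
  have h1 := (growthSpace_mono W (Nat.le_succ n)).trans (growthSpace_le_growthSpace_mul h (n + 1))
  rw [growthSpace_wordSpan c (Nat.mul_pos ha n.succ_pos)] at h1
  have := finiteDimensional_wordSpan (K := K) c (a * (n + 1))
  exact Submodule.finiteDimensional_of_le h1

theorem growthFun_mono (c : G.SpecialEdges) [Finite V] {W : Submodule K (G.LeavittPathAlgebra K)}
    (hW : IsGeneratingSpace W) : Monotone (growthFun W) := fun m n hmn => by
  have := finiteDimensional_growthSpace c hW n
  exact Submodule.finrank_mono (growthSpace_mono W hmn)

/-- Every generating space grows at most as fast as the number of reduced words. -/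
theorem exists_growthFun_le [Finite V] {W : Submodule K (G.LeavittPathAlgebra K)}
    (hW : IsGeneratingSpace W) :
    ∃ a, 1 ≤ a ∧ ∀ n, 1 ≤ n → growthFun W n ≤ (reducedWords c (a * n)).ncard := by
  have := hW.1
  obtain ⟨a, ha, h⟩ := (isGeneratingSpace_wordSpan (K := K) c).exists_le_growthSpace W
  refine ⟨a, ha, fun n hn => ?_⟩
  have h1 := growthSpace_le_growthSpace_mul h n
  rw [growthSpace_wordSpan c (Nat.mul_pos ha hn)] at h1
  have := finiteDimensional_wordSpan (K := K) c (a * n)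
  rw [← finrank_wordSpan (K := K)]
  exact Submodule.finrank_mono h1

/-- The number of reduced words grows at most as fast as every generating space. -/
theorem exists_ncard_le_growthFun [Finite V] {W : Submodule K (G.LeavittPathAlgebra K)}
    (hW : IsGeneratingSpace W) :
    ∃ b, 1 ≤ b ∧ ∀ n, 1 ≤ n → (reducedWords c n).ncard ≤ growthFun W (b * n) := by
  have := finiteDimensional_wordSpan (K := K) c 1
  obtain ⟨b, hb, h⟩ := hW.exists_le_growthSpace (wordSpan c K 1)
  refine ⟨b, hb, fun n hn => ?_⟩
  have h1 := growthSpace_le_growthSpace_mul h n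
  rw [growthSpace_wordSpan c hn] at h1
  rw [← finrank_wordSpan (K := K)]
  have := finiteDimensional_growthSpace c hW (b * n)
  exact Submodule.finrank_mono h1

end Basis

end WeightedGraph

/-! ### Growth exponents -/

theorem not_forall_two_pow_le (C : ℝ) (m : ℕ) : ¬ ∀ n : ℕ, (2 : ℝ) ^ n ≤ C * (n + 1 : ℝ) ^ m := by
  intro h
  have ht := (tendsto_pow_const_div_const_pow_of_one_lt m (one_lt_two (α := ℝ))).const_mul (2 * C)
  rw [mul_zero] at ht
  have h1 : ∀ᶠ n : ℕ in Filter.atTop, (1 : ℝ) ≤ 2 * C * ((n : ℝ) ^ m / 2 ^ n) := by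
    filter_upwards [Filter.eventually_ge_atTop 1] with n hn
    obtain ⟨k, rfl⟩ := Nat.exists_eq_add_of_le' hn
    have := h k
    rw [← mul_div_assoc, le_div_iff₀ (by positivity), pow_succ]
    push_cast
    linarith
  have := ge_of_tendsto ht h1
  norm_num at this

/-- Constant factors change `log_n f(n)` only by a constant divided by `log n`, so the sequence is
squeezed to `d`. -/
theorem limsup_logb_eq {f : ℕ → ℕ} {d : ℕ} {A B : ℝ} (hA : 0 < A) (hB : 0 < B)
    (hlow : ∀ᶠ n : ℕ in Filter.atTop, (n : ℝ) ^ d ≤ A * f n)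
    (hup : ∀ᶠ n : ℕ in Filter.atTop, (f n : ℝ) ≤ B * (n : ℝ) ^ d) :
    Filter.limsup (fun n : ℕ => (Real.logb n (f n) : EReal)) Filter.atTop = (d : EReal) := by
  have hlog : Filter.Tendsto (fun n : ℕ => Real.log n) Filter.atTop Filter.atTop :=
    Real.tendsto_log_atTop.comp tendsto_natCast_atTop_atTop
  have hl : Filter.Tendsto (fun n : ℕ => (d : ℝ) - Real.log A / Real.log n) Filter.atTop
      (nhds (d : ℝ)) := by
    simpa using (hlog.const_div_atTop (Real.log A)).const_sub (d : ℝ)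
  have hu : Filter.Tendsto (fun n : ℕ => (d : ℝ) + Real.log B / Real.log n) Filter.atTop
      (nhds (d : ℝ)) := by
    simpa using (hlog.const_div_atTop (Real.log B)).const_add (d : ℝ)
  have key : Filter.Tendsto (fun n : ℕ => Real.logb n (f n)) Filter.atTop (nhds (d : ℝ)) := by
    refine tendsto_of_tendsto_of_tendsto_of_le_of_le' hl hu ?_ ?_
    · filter_upwards [hlow, Filter.eventually_ge_atTop 2] with n h1 hn
      have hn1 : (1 : ℝ) < n := by exact_mod_cast hn
      have hln : 0 < Real.log n := Real.log_pos hn1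
      have hpos : 0 < (n : ℝ) ^ d := by positivity
      have hf : 0 < (f n : ℝ) := pos_of_mul_pos_right (hpos.trans_le h1) hA.le
      have h2 := Real.log_le_log hpos h1
      rw [Real.log_pow, Real.log_mul hA.ne' hf.ne'] at h2
      rw [Real.logb, le_div_iff₀ hln, sub_mul, div_mul_cancel₀ _ hln.ne']
      linarith
    · filter_upwards [hlow, hup, Filter.eventually_ge_atTop 2] with n h1 h1' hn
      have hn1 : (1 : ℝ) < n := by exact_mod_cast hn
      have hln : 0 < Real.log n := Real.log_pos hn1
      have hpos : 0 < (n : ℝ) ^ d := by positivity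
      have hf : 0 < (f n : ℝ) := pos_of_mul_pos_right (hpos.trans_le h1) hA.le
      have h2 := Real.log_le_log hf h1'
      rw [Real.log_mul hB.ne' hpos.ne', Real.log_pow] at h2
      rw [Real.logb, div_le_iff₀ hln, add_mul, div_mul_cancel₀ _ hln.ne']
      linarith
  have := ((continuous_coe_real_ereal.tendsto (d : ℝ)).comp key).limsup_eq
  rw [EReal.coe_natCast] at this
  exact this

/-! ### Nod-paths as walks -/

namespace WeightedGraph

open IdxEdge RelWalk

variable {V E : Type*}

theorem pathLength_map {α β : Type*} (l : List β) :
    pathLength (l.map (Sum.inr : β → α ⊕ β)) = l.length := by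
  rw [pathLength, List.countP_map, List.countP_eq_length]
  simp

theorem isRotated_map_iff {α β : Type*} {f : α → β} (hf : Function.Injective f) {l m : List α} :
    (l.map f).IsRotated (m.map f) ↔ l.IsRotated m := by
  refine ⟨fun ⟨n, hn⟩ => ⟨n, ?_⟩, fun h => h.map f⟩
  rw [← List.map_rotate] at hn
  exact hf.list_map hn

variable [Fintype E] {G : WeightedGraph V E} (c : G.SpecialEdges)

/-- Two edges of the double graph that may follow each other in a nod-path. -/
def NodRel (x y : G.DEdge) : Prop :=
  G.hat.double.rng x = G.hat.double.src y ∧ ¬ Forbidden c [Sum.inr x, Sum.inr y]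

/-- All forbidden words have exactly two letters. This is why avoiding them is a condition on
adjacent letters and nod-paths become walks. -/
theorem forbidden_iff {q : List G.Letter} :
    Forbidden c q ↔ ∃ x y, q = [Sum.inr x, Sum.inr y] ∧ Clash c (toIdx x) (toIdx y) := by
  constructor
  · rintro (⟨v, hv, i, j⟩ | ⟨e, f, h⟩)
    · exact ⟨_, _, rfl, rfl, isSpecial_edge c v hv⟩
    · exact ⟨_, _, rfl, rfl, rfl, h⟩
  · rintro ⟨x, y, rfl, h⟩
    match x, y, h with
    | Sum.inl ⟨e, i⟩, Sum.inr ⟨f, j⟩, h =>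
      obtain ⟨h1, hsp⟩ := h
      obtain rfl : e = f := h1
      have aux : ∀ v hv, e = c.edge v hv → Forbidden c
          [Sum.inr (Sum.inl ⟨e, i⟩), Sum.inr (Sum.inr ⟨e, j⟩)] := by
        rintro v hv rfl
        exact .real_ghost v hv i j
      exact aux _ _ hsp.symm
    | Sum.inr ⟨e, i⟩, Sum.inl ⟨f, j⟩, h =>
      obtain ⟨hi, hj, hef⟩ := h
      obtain rfl : i = ⟨0, G.weight_pos e⟩ := Fin.ext hi
      obtain rfl : j = ⟨0, G.weight_pos f⟩ := Fin.ext hj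
      exact .ghost_real e f hef

theorem forbidden_pair_iff {x y : G.DEdge} :
    Forbidden c [Sum.inr x, Sum.inr y] ↔ Clash c (toIdx x) (toIdx y) := by
  rw [forbidden_iff]
  constructor
  · rintro ⟨x', y', h, hcl⟩
    simp only [List.cons.injEq, Sum.inr.injEq, and_true] at h
    rwa [h.1, h.2]
  · exact fun h => ⟨x, y, rfl, h⟩

/-- The end vertex carries information for the empty word only, where it accounts for the nod-paths
of length 0; otherwise the last letter determines it. -/
theorem reduced_map_iff {l : List G.DEdge} {v : V} :
    Reduced c (l.map toIdx) v ↔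
      l.IsChain (NodRel c) ∧ ∀ x ∈ l.getLast?, G.hat.double.rng x = v := by
  have hrng : ∀ x : G.DEdge, G.idxRng (toIdx x) = G.hat.double.rng x := by
    rintro (x | x) <;> rfl
  have hsrc : ∀ x : G.DEdge, G.idxSrc (toIdx x) = G.hat.double.src x := by
    rintro (x | x) <;> rfl
  induction l with
  | nil => simp [Reduced]
  | cons x l ih =>
    simp only [List.map_cons, Reduced, ih]
    cases l with
    | nil => simp [inRange_toIdx, hrng, wordSrc]
    | cons y l =>
      rw [List.isChain_cons_cons, List.getLast?_cons_cons, NodRel, forbidden_pair_iff]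
      simp only [inRange_toIdx, hrng, wordSrc, hsrc, List.map_cons, List.head?_cons,
        Option.mem_def, Option.some.injEq, forall_eq', true_and]
      tauto

theorem isNodPath_map_iff {l : List G.DEdge} (hl : l ≠ []) :
    IsNodPath c (l.map Sum.inr) ↔ l.IsChain (NodRel c) := by
  constructor
  · rintro ⟨hp, hq⟩
    have hch : l.IsChain (fun x y => G.hat.double.rng x = G.hat.double.src y) := by
      rcases hp with ⟨v, hv⟩ | ⟨l', -, h, he⟩
      · obtain ⟨x, l, rfl⟩ := List.exists_cons_of_ne_nil hl
        simp at hv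
      · rwa [Sum.inr_injective.list_map he]
    rw [List.isChain_iff_forall_rel_of_append_cons_cons] at hch ⊢
    intro a b l₁ l₂ he
    exact ⟨hch he, hq _ ⟨l₁.map Sum.inr, l₂.map Sum.inr, by rw [he]; simp⟩⟩
  · intro h
    refine ⟨.inr ⟨l, hl, h.imp fun _ _ => And.left, rfl⟩, fun q hq hf => ?_⟩
    obtain ⟨q, hq', rfl⟩ := List.infix_map_iff.1 hq
    obtain ⟨x, y, he, -⟩ := (forbidden_iff c).1 hf
    obtain rfl : q = [x, y] := Sum.inr_injective.list_map he
    exact (List.isChain_pair.1 (h.infix hq')).2 hf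

/-- A path that contains a vertex letter has only one letter, so a path with two nonempty factors
consists of edges. -/
theorem IsNodPath.exists_map {p q : List G.Letter} (h : IsNodPath c (p ++ q)) (hp : p ≠ [])
    (hq : q ≠ []) :
    ∃ l m : List G.DEdge, p = l.map Sum.inr ∧ q = m.map Sum.inr ∧ l ≠ [] ∧ m ≠ [] := by
  rcases h.1 with ⟨v, hv⟩ | ⟨l, -, -, he⟩
  · have := congrArg List.length hv
    have h1 := List.length_pos_iff.2 hp
    have h2 := List.length_pos_iff.2 hq
    simp at this
    omega
  · obtain ⟨l₁, l₂, rfl, rfl, rfl⟩ := List.map_eq_append_iff.1 he.symm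
    exact ⟨l₁, l₂, rfl, rfl, by simpa using hp, by simpa using hq⟩

variable {c} in
theorem IsNodPath.ne_nil {p : List G.Letter} (h : IsNodPath c p) : p ≠ [] := by
  rintro rfl
  rcases h.1 with ⟨v, hv⟩ | ⟨l, hl, -, he⟩
  · simp at hv
  · simp [hl] at he

/-- A vertex is never a nod²-path, because the word `vv` is not a path. Hence nod²-paths are words
of edges. -/
theorem isNodSqPath_iff {p : List G.Letter} :
    IsNodSqPath c p ↔ ∃ l, p = l.map Sum.inr ∧ IsClosed (NodRel c) l := by
  constructor
  · rintro ⟨h1, h2⟩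
    obtain ⟨l, -, rfl, -, hl, -⟩ := h2.exists_map c h1.ne_nil h1.ne_nil
    rw [← List.map_append, isNodPath_map_iff c (by simp [hl])] at h2
    exact ⟨l, rfl, hl, h2⟩
  · rintro ⟨l, rfl, hl, h⟩
    refine ⟨(isNodPath_map_iff c hl).2 h.left_of_append, ?_⟩
    rw [← List.map_append]
    exact (isNodPath_map_iff c (by simp [hl])).2 h

theorem isQuasiCycle_map_iff {l : List G.DEdge} :
    IsQuasiCycle c (l.map Sum.inr) ↔ IsMinimalClosed (NodRel c) l := by
  have hsq : ∀ l : List G.DEdge, IsNodSqPath c (l.map Sum.inr) ↔ IsClosed (NodRel c) l := by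
    intro l
    rw [isNodSqPath_iff]
    constructor
    · rintro ⟨l', he, h⟩
      rwa [Sum.inr_injective.list_map he]
    · exact fun h => ⟨l, rfl, h⟩
  unfold IsQuasiCycle IsMinimalClosed
  rw [hsq, ← List.map_append, pathLength_map]
  refine and_congr_right fun _ => ⟨fun h q hq hlt hcl => ?_, fun h q hq hlt hcl => ?_⟩
  · exact h (q.map Sum.inr) (List.infix_map_iff.2 ⟨q, hq, rfl⟩) (by rwa [pathLength_map])
      ((hsq q).2 hcl)
  · obtain ⟨q, hq', rfl⟩ := List.infix_map_iff.1 hq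
    rw [pathLength_map] at hlt
    exact h q hq' hlt ((hsq q).1 hcl)

theorem IsQuasiCycle.exists_map {p : List G.Letter} (h : IsQuasiCycle c p) :
    ∃ l : List G.DEdge, p = l.map Sum.inr ∧ IsMinimalClosed (NodRel c) l := by
  obtain ⟨l, rfl, -⟩ := (isNodSqPath_iff c).1 h.1
  exact ⟨l, rfl, (isQuasiCycle_map_iff c).1 h⟩

theorem nodConnects_map_iff {l m : List G.DEdge} (hl : l ≠ []) (hm : m ≠ []) :
    NodConnects c (l.map Sum.inr) (m.map Sum.inr) ↔ Links (NodRel c) l m := by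
  constructor
  · rintro ⟨o, ho, hpo, h⟩
    have h' := h
    rw [List.append_assoc] at h'
    -- The connecting path cannot be a single vertex, since it is a factor of a path with further
    -- letters.
    obtain ⟨-, t, -, ht, -⟩ := h'.exists_map c (by simpa using hl) (by simp [hm])
    obtain ⟨o, -, -, rfl, -⟩ := List.map_eq_append_iff.1 ht.symm
    rw [← List.map_append, ← List.map_append, isNodPath_map_iff c (by simp [hl])] at h
    rw [List.prefix_map_iff_of_injective Sum.inr_injective] at hpo
    exact ⟨o, by simpa using ho.ne_nil, hpo, h⟩
  · rintro ⟨o, ho, hpo, h⟩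
    refine ⟨o.map Sum.inr, (isNodPath_map_iff c ho).2 h.left_of_append.right_of_append, ?_, ?_⟩
    · rwa [List.prefix_map_iff_of_injective Sum.inr_injective]
    · rw [← List.map_append, ← List.map_append]
      exact (isNodPath_map_iff c (by simp [hl])).2 h

theorem noSelfLink_iff : NoSelfLink (NodRel c) ↔ ¬ ∃ p, IsSelfconnected c p := by
  constructor
  · rintro h ⟨p, hp, hpp⟩
    obtain ⟨l, rfl, hl⟩ := hp.exists_map
    exact h l hl ((nodConnects_map_iff c hl.1.1 hl.1.1).1 hpp)
  · exact fun h l hl hll => h ⟨l.map Sum.inr, (isQuasiCycle_map_iff c).2 hl,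
      (nodConnects_map_iff c hl.1.1 hl.1.1).2 hll⟩

theorem isQuasiCycleChain_map_iff {L : List (List G.DEdge)} :
    IsQuasiCycleChain c (L.map (List.map Sum.inr)) ↔ IsMinimalClosedChain (NodRel c) L := by
  unfold IsQuasiCycleChain IsMinimalClosedChain
  rw [List.forall_mem_map, List.pairwise_map, List.isChain_map]
  simp only [isQuasiCycle_map_iff, isRotated_map_iff (Sum.inr_injective (α := V) (β := G.DEdge))]
  refine and_congr_right fun hL => and_congr_right fun _ => List.IsChain.iff_of_mem_imp ?_
  intro p q hp hq
  have hp0 := (hL p hp).1.1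
  have hq0 := (hL q hq).1.1
  rw [Connects, nodConnects_map_iff c hp0 hq0, ← List.map_append,
    isNodPath_map_iff c (by simp [hp0])]

theorem exists_isQuasiCycleChain_iff {k : ℕ} :
    (∃ L, IsQuasiCycleChain c L ∧ L.length = k) ↔
      ∃ L, IsMinimalClosedChain (NodRel c) L ∧ L.length = k := by
  constructor
  · rintro ⟨L, hL, rfl⟩
    have hex : ∃ L' : List (List G.DEdge), L'.map (List.map Sum.inr) = L := by
      have h := hL.1
      clear hL
      induction L with
      | nil => exact ⟨[], rfl⟩
      | cons p L ih =>
        obtain ⟨L', rfl⟩ := ih fun q hq => h q (List.mem_cons_of_mem _ hq)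
        obtain ⟨l, rfl, -⟩ := (h p (by simp)).exists_map
        exact ⟨l :: L', rfl⟩
    obtain ⟨L', rfl⟩ := hex
    exact ⟨L', (isQuasiCycleChain_map_iff c).1 hL, by simp⟩
  · rintro ⟨L, hL, rfl⟩
    exact ⟨_, (isQuasiCycleChain_map_iff c).2 hL, by simp⟩

/-! ### Counting reduced words -/

theorem card_le_ncard_reducedWords [Finite V] [Nonempty V] {n : ℕ} {S : Finset (List G.DEdge)}
    (hS : ∀ l ∈ S, l ≠ [] ∧ l.IsChain (NodRel c) ∧ l.length ≤ n) :
    S.card ≤ (reducedWords c n).ncard := by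
  rw [← Set.ncard_coe_finset]
  -- The arbitrary vertex is a dummy default: the lists in `S` are nonempty, so the last letter
  -- supplies the end vertex.
  refine Set.ncard_le_ncard_of_injOn (fun l : List G.DEdge =>
    (l.map toIdx, (l.getLast?.map G.hat.double.rng).getD (Classical.arbitrary V))) ?_ ?_
    (reducedWords_finite c n)
  · intro l hl
    obtain ⟨h0, hc, hlen⟩ := hS l hl
    refine ⟨(reduced_map_iff c).2 ⟨hc, fun x hx => ?_⟩, by simpa using hlen⟩
    rw [Option.mem_def] at hx
    simp [hx]
  · intro l _ m _ h
    exact toIdx_injective.list_map (congrArg Prod.fst h)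

theorem one_le_ncard_reducedWords [Finite V] [Nonempty V] (n : ℕ) :
    1 ≤ (reducedWords c n).ncard := by
  rw [Nat.one_le_iff_ne_zero, Ne, Set.ncard_eq_zero (reducedWords_finite c n)]
  exact Set.Nonempty.ne_empty ⟨([], Classical.arbitrary V), trivial, Nat.zero_le n⟩

theorem ncard_reducedWords_le [Finite V] (n : ℕ) :
    (reducedWords c n).ncard ≤
      (1 + ∑ x, walkCount (NodRel c) n x) * Nat.card V := by
  classical
  have hfin : ∀ x : G.DEdge, {l : List G.DEdge | (x :: l).IsChain (NodRel c) ∧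
      l.length ≤ n}.Finite := fun x => (List.finite_length_le _ n).subset fun l hl => hl.2
  let T : Set (List G.DEdge) := {[]} ∪ ⋃ x ∈ (Finset.univ : Finset G.DEdge),
    (List.cons x) '' {l | (x :: l).IsChain (NodRel c) ∧ l.length ≤ n}
  have hT : T.Finite := (Set.finite_singleton _).union
    (Set.Finite.biUnion (Finset.finite_toSet _) fun x _ => (hfin x).image _)
  have hTcard : T.ncard ≤ 1 + ∑ x, walkCount (NodRel c) n x := by
    refine (Set.ncard_union_le _ _).trans ?_
    rw [Set.ncard_singleton]
    refine Nat.add_le_add_left ((Finset.set_ncard_biUnion_le _ _).trans ?_) 1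
    exact Finset.sum_le_sum fun x _ => (Set.ncard_image_le (hfin x)).trans (ncard_walks_le n x)
  have hsub : reducedWords c n ⊆
      (fun p : List G.DEdge × V => (p.1.map toIdx, p.2)) '' (T ×ˢ Set.univ) := by
    rintro ⟨l, v⟩ ⟨h, hl⟩
    obtain ⟨l, rfl⟩ := exists_map_toIdx_eq c h
    refine ⟨(l, v), ⟨?_, trivial⟩, rfl⟩
    match l with
    | [] => exact .inl rfl
    | x :: l =>
      refine .inr (Set.mem_iUnion₂.2 ⟨x, by simp, l, ⟨((reduced_map_iff c).1 h).1, ?_⟩, rfl⟩)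
      simp at hl
      omega
  have hprod := hT.prod (Set.finite_univ (α := V))
  calc _ ≤ _ := Set.ncard_le_ncard hsub (hprod.image _)
    _ ≤ (T ×ˢ Set.univ).ncard := Set.ncard_image_le hprod
    _ = T.ncard * Nat.card V := by rw [Set.ncard_prod, Set.ncard_univ]
    _ ≤ _ := Nat.mul_le_mul_right _ hTcard

theorem exists_ncard_reducedWords_le [Finite V] (hR : NoSelfLink (NodRel c)) {d : ℕ}
    (hd : ∀ L, IsMinimalClosedChain (NodRel c) L → L.length ≤ d) :
    ∃ B, 1 ≤ B ∧ ∀ n, 1 ≤ n → (reducedWords c n).ncard ≤ B * n ^ d := by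
  have hex : ∀ x : G.DEdge, ∃ C, ∀ n, walkCount (NodRel c) n x ≤ C * (n + 1) ^ d := fun x =>
    hR.exists_walkCount_le x d fun L hL hb => by
      obtain ⟨L', hL', hlen⟩ := exists_isMinimalClosedChain (fun y hy => (hL y hy).1) hb
      exact hlen ▸ hd L' hL'
  choose C hC using hex
  -- The factor `2 ^ d` comes from `n + 1 ≤ 2n`, the factor `Nat.card V` bounds the choice of end
  -- vertex, and the final 1 makes the constant positive.
  refine ⟨(1 + ∑ x, C x) * 2 ^ d * Nat.card V + 1, by omega, fun n hn => ?_⟩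
  have h1 : 1 + ∑ x, walkCount (NodRel c) n x ≤ (1 + ∑ x, C x) * (2 ^ d * n ^ d) := by
    rw [← mul_pow]
    have h2 : n + 1 ≤ 2 * n := by omega
    have h3 : ∑ x, walkCount (NodRel c) n x ≤ (∑ x, C x) * (2 * n) ^ d := by
      rw [Finset.sum_mul]
      exact Finset.sum_le_sum fun x _ => (hC x n).trans
        (Nat.mul_le_mul_left _ (Nat.pow_le_pow_left h2 d))
    have h4 : 1 ≤ (2 * n) ^ d := Nat.one_le_pow _ _ (by omega)
    rw [add_mul, one_mul]
    omega
  calc _ ≤ _ := ncard_reducedWords_le c n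
    _ ≤ (1 + ∑ x, C x) * (2 ^ d * n ^ d) * Nat.card V := Nat.mul_le_mul_right _ h1
    _ = (1 + ∑ x, C x) * 2 ^ d * Nat.card V * n ^ d := by ring
    _ ≤ _ := Nat.mul_le_mul_right _ (Nat.le_succ _)

theorem exists_pow_le_ncard_reducedWords [Finite V] [Nonempty V] (hR : NoSelfLink (NodRel c))
    {L : List (List G.DEdge)} (hL : IsMinimalClosedChain (NodRel c) L) :
    ∃ A, 1 ≤ A ∧ ∀ m, 1 ≤ m → m ^ L.length ≤ (reducedWords c (A * m)).ncard := by
  obtain ⟨L', hlen, hcyc, hb⟩ := hR.exists_below_chain hL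
  rw [← hlen]
  cases L' with
  | nil => exact ⟨1, le_rfl, fun m _ => by simpa using one_le_ncard_reducedWords c (1 * m)⟩
  | cons x L' =>
    obtain ⟨A, hA⟩ := exists_many_walks hcyc hb
    refine ⟨A + 1, by omega, fun m hm => ?_⟩
    obtain ⟨S, hcard, hS⟩ := hA m hm
    refine hcard.trans (card_le_ncard_reducedWords c fun l hl => ?_)
    obtain ⟨⟨l', rfl⟩, h1, h2⟩ := hS l hl
    exact ⟨by simp, h1, h2.trans (Nat.mul_le_mul_right _ (Nat.le_succ _))⟩

/-! ### Growth and Gelfand-Kirillov dimension of the algebra -/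

variable {K : Type*} [Field K]

theorem noSelfLink_of_hasPolynomialGrowth [Finite V] [Nonempty V]
    (h : HasPolynomialGrowth K (G.LeavittPathAlgebra K)) : NoSelfLink (NodRel c) := by
  intro p hp hpp
  obtain ⟨W, hW, m, -, a, -, ha⟩ := h
  obtain ⟨b, hb, hbW⟩ := exists_ncard_le_growthFun c hW
  obtain ⟨M, hM⟩ := hp.exists_exponential_of_links hpp
  -- There are `2^n` walks of length at most `(M + 1)(n + 1)`; `b` passes from reduced words to `W`,
  -- and `a`, `m` come from the growth bound. `M + 1` replaces `M` to keep the length positive.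
  refine not_forall_two_pow_le (a * (a * b * (M + 1)) ^ m) m fun n => ?_
  obtain ⟨S, hcard, hS⟩ := hM n
  have hpos : 1 ≤ (M + 1) * (n + 1) := Nat.mul_pos M.succ_pos n.succ_pos
  have h1 : S.card ≤ (reducedWords c ((M + 1) * (n + 1))).ncard :=
    card_le_ncard_reducedWords c fun l hl => ⟨(hS l hl).1, (hS l hl).2.1,
      (hS l hl).2.2.trans (Nat.mul_le_mul_right _ (Nat.le_succ _))⟩
  have h2 := h1.trans (hbW _ hpos)
  have h3 := ha _ (Nat.mul_pos hb hpos)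
  rw [hcard] at h2
  calc (2 : ℝ) ^ n = ((2 ^ n : ℕ) : ℝ) := by push_cast; rfl
    _ ≤ (growthFun W (b * ((M + 1) * (n + 1))) : ℝ) := by exact_mod_cast h2
    _ ≤ _ := h3
    _ = a * (a * b * (M + 1) * (n + 1)) ^ m := by push_cast; ring
    _ = _ := by rw [mul_pow _ (n + 1 : ℝ), ← mul_assoc (a : ℝ) (_ ^ m)]

/-- The set of lengths contains 0, from the empty chain, and is bounded because descending chains of
vertices have no repetitions. -/
theorem exists_isGreatest_chain (hR : NoSelfLink (NodRel c)) :
    ∃ d, IsGreatest {k | ∃ L, IsMinimalClosedChain (NodRel c) L ∧ L.length = k} d := by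
  refine ⟨_, Nat.sSup_mem ⟨0, [], by simp [IsMinimalClosedChain], rfl⟩ ?_, ?_⟩
  on_goal 2 => refine fun k hk => le_csSup ?_ hk
  all_goals
    refine ⟨Fintype.card G.DEdge, ?_⟩
    rintro k ⟨L, hL, rfl⟩
    obtain ⟨L', hlen, -, hb⟩ := hR.exists_below_chain hL
    exact hlen ▸ length_le_card_of_below_chain hb

theorem hasPolynomialGrowth_of_noSelfLink [Finite V] (hR : NoSelfLink (NodRel c)) :
    HasPolynomialGrowth K (G.LeavittPathAlgebra K) := by
  obtain ⟨d, hd⟩ := exists_isGreatest_chain c hR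
  obtain ⟨B, hB1, hB⟩ := exists_ncard_reducedWords_le c hR fun L hL => hd.2 ⟨L, hL, rfl⟩
  -- The exponent is `d + 1` because polynomial growth asks for a positive exponent and `d` may be
  -- 0.
  refine ⟨wordSpan c K 1, isGeneratingSpace_wordSpan c, d + 1, by omega, B, hB1, fun n hn => ?_⟩
  have h1 : growthFun (wordSpan c K 1) n ≤ B * (B * n) ^ (d + 1) := by
    rw [growthFun, growthSpace_wordSpan c hn, finrank_wordSpan]
    refine (hB n hn).trans (Nat.mul_le_mul_left _ ?_)
    have h2 : n ≤ B * n := Nat.le_mul_of_pos_left n hB1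
    exact (Nat.pow_le_pow_left h2 d).trans (Nat.pow_le_pow_right (by omega) (by omega))
  dsimp only
  exact_mod_cast h1

theorem isGKDim_of_isGreatest [Finite V] [Nonempty V] (hR : NoSelfLink (NodRel c)) {d : ℕ}
    (hd : IsGreatest {k | ∃ L, IsMinimalClosedChain (NodRel c) L ∧ L.length = k} d) :
    IsGKDim K (G.LeavittPathAlgebra K) d := by
  refine ⟨⟨_, isGeneratingSpace_wordSpan c⟩, fun W hW => ?_⟩
  obtain ⟨B, hB1, hB⟩ := exists_ncard_reducedWords_le c hR fun L hL => hd.2 ⟨L, hL, rfl⟩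
  obtain ⟨L, hL, rfl⟩ := hd.1
  obtain ⟨A, hA1, hA⟩ := exists_pow_le_ncard_reducedWords c hR hL
  obtain ⟨a, ha1, ha⟩ := exists_growthFun_le c hW
  obtain ⟨b, hb1, hb⟩ := exists_ncard_le_growthFun c hW
  have hq1 : 1 ≤ b * A := Nat.mul_pos hb1 hA1
  -- The lower bound is known along multiples of `b * A` only. It is applied to the quotient of `n`
  -- by `b * A`, and rounding down costs at most a factor 2 once `n ≥ b * A`.
  refine limsup_logb_eq (A := ((2 * (b * A)) ^ L.length : ℕ)) (B := (B * a ^ L.length : ℕ))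
    (by positivity) (by positivity) ?_ ?_
  · filter_upwards [Filter.eventually_ge_atTop (b * A)] with n hn
    have hm : 1 ≤ n / (b * A) := (Nat.one_le_div_iff hq1).2 hn
    have h1 := (hA _ hm).trans (hb _ (Nat.mul_pos hA1 hm))
    have h2 : b * (A * (n / (b * A))) ≤ n := by
      rw [← mul_assoc]; exact Nat.mul_div_le n (b * A)
    have h3 := h1.trans (growthFun_mono c hW h2)
    have h4 : n ≤ 2 * (b * A) * (n / (b * A)) := by
      have h5 := Nat.lt_mul_div_succ n hq1
      have h6 : b * A ≤ b * A * (n / (b * A)) := Nat.le_mul_of_pos_right _ hm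
      rw [Nat.mul_succ] at h5
      rw [mul_assoc]
      omega
    have h5 : n ^ L.length ≤ (2 * (b * A)) ^ L.length * growthFun W n := by
      refine (Nat.pow_le_pow_left h4 _).trans ?_
      rw [mul_pow]
      exact Nat.mul_le_mul_left _ h3
    exact_mod_cast h5
  · filter_upwards [Filter.eventually_ge_atTop 1] with n hn
    have h1 : growthFun W n ≤ B * a ^ L.length * n ^ L.length := by
      refine (ha n hn).trans ((hB _ (Nat.mul_pos ha1 hn)).trans_eq ?_)
      ring
    exact_mod_cast h1

end WeightedGraph

theorem mainTheorem1 {K V E : Type*} [Field K] [Finite V] [Nonempty V] [Fintype E]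
    (G : WeightedGraph V E) (c : G.SpecialEdges) :
    (HasPolynomialGrowth K (G.LeavittPathAlgebra K) ↔
      ¬ ∃ p, WeightedGraph.IsSelfconnected c p) ∧
    (HasPolynomialGrowth K (G.LeavittPathAlgebra K) →
      ∃ d : ℕ, IsGreatest {k | ∃ L, WeightedGraph.IsQuasiCycleChain c L ∧ L.length = k} d ∧
        IsGKDim K (G.LeavittPathAlgebra K) d) := by
  constructor
  · rw [← WeightedGraph.noSelfLink_iff]
    exact ⟨WeightedGraph.noSelfLink_of_hasPolynomialGrowth c,
      WeightedGraph.hasPolynomialGrowth_of_noSelfLink c⟩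
  · intro h
    have hR := WeightedGraph.noSelfLink_of_hasPolynomialGrowth c h
    obtain ⟨d, hd⟩ := WeightedGraph.exists_isGreatest_chain c hR
    refine ⟨d, ?_, WeightedGraph.isGKDim_of_isGreatest c hR hd⟩
    simpa only [WeightedGraph.exists_isQuasiCycleChain_iff] using hd
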